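/- Conventions. A \emph{continuum} is a nonempty compact connected Hausdorff space; the weight of a space is the least cardinality of a base for its open sets; $\mathfrak c=2^{\aleph_0}$. Let $X=\omega\times[0,1]$ ($\omega$ discrete) and let $X^*=\beta X\setminus X$ be its Čech–Stone remainder. For an ultrafilter $u$ on $\omega$ put $$\mathbb I_u=\bigcap_{U\in u}\operatorname{cl}_{\beta X}(U\times[0,1]).$$ Let $\mathcal I$ be the bounded lattice of all finite unions of closed intervals in $[0,1]$ with rational end points (one-point intervals and the empty union allowed), and let $\mathcal I^\omega/u$ be its ultrapower, a structure for the language $\{\vee,\wedge,0,1\}$ of bounded lattices. A structure $M$ is \emph{$\kappa$-saturated} if every set of first-order formulas in one free variable, with parameters from a subset of $M$ of size less than $\kappa$, that is finitely satisfiable in $M$ is satisfied by some element of $M$. It is \emph{$\kappa$-universal} if every structure of size less than $\kappa$ that is elementarily equivalent to $M$ embeds elementarily into $M$. An ultrafilter $u$ on $\omega$ is \emph{$\kappa$-saturated} if for every countable structure $M$ in a countable language the ultrapower $M^\omega/u$ is $\kappa$-saturated. Theorem. Let $u$ be an ultrafilter on $\omega$. (1) If $u$ is free, then: (a) $\mathbb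 I_u$ is a continuum, it is contained in $X^*$ and it is a connected component of $X^*$; its weight is $\mathfrak c$. (b) The assignment $F\mapsto \mathbb I_u\cap\operatorname{cl}_{\beta X}\bigl(\bigcup_{n\in\omega}\{n\}\times F_n\bigr)$ (for $F=(F_n)_n\in\mathcal I^\omega$) induces an embedding of bounded lattices of $\mathcal I^\omega/u$ into the lattice of closed subsets of $\mathbb I_u$, and its range is a base for the closed sets of $\mathbb I_u$. (c) The lattice $\mathcal I^\omega/u$ is $\aleph_1$-saturated. (d) Every continuum of weight at most $\aleph_1$ is a continuous image of $\mathbb I_u$. (2) If $u$ is $\mathfrak c$-saturated, then $u$ is free (so (1) applies), the lattice $\mathcal I^\omega/u$ is $\mathfrak c$-saturated and $\mathfrak c^+$-universal, and every continuum of weight at most $\mathfrak c$ is a continuous image of $\mathbb I_u$. Thus $\mathbb I_u$ is a universal continuum of weight $\mathfrak c$. -/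

import Mathlib

open Set Filter Topology TopologicalSpace FirstOrder
open scoped Cardinal

universe v

namespace UniversalContinuum

/-! ### Saturation, universality and saturated ultrafilters -/

/-- A structure `M` is `κ`-saturated if every set of formulas in one free variable, with parameters
from a subset of `M` of size less than `κ`, all of whose finite subsets have a solution in `M`, has
a solution in `M`. -/
def IsSaturated (L : FirstOrder.Language.{0, 0}) (M : Type) [L.Structure M] (κ : Cardinal.{0}) : Prop :=
  ∀ A : Set M, #A < κ → ∀ p : Set (L[[A]].Formula (Fin 1)),
    (∀ Δ ⊆ p, Δ.Finite → ∃ x : M, ∀ φ ∈ Δ, φ.Realize (fun _ => x)) →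
    ∃ x : M, ∀ φ ∈ p, φ.Realize (fun _ => x)

/-- A structure `M` is `κ`-universal if every structure of size less than `κ` that is elementarily
equivalent to `M` is elementarily embeddable into `M`. -/
def IsUniversal (L : FirstOrder.Language.{0, 0}) (M : Type) [L.Structure M] (κ : Cardinal.{0}) : Prop :=
  ∀ (N : Type) [L.Structure N] [Nonempty N], #N < κ → L.ElementarilyEquivalent N M →
    Nonempty (N ↪ₑ[L] M)

/-- The ultrapower `M^ω/u`; it carries the `L`-structure of the ultraproduct. -/
abbrev Ultrapower (u : Ultrafilter ℕ) (M : Type) : Type :=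
  (u : Filter ℕ).Product (fun _ => M)

/-- The class in `M^ω/u` of a sequence of elements of `M`. -/
def Ultrapower.mk (u : Ultrafilter ℕ) {M : Type} (F : ℕ → M) : Ultrapower u M :=
  Quotient.mk ((u : Filter ℕ).productSetoid (fun _ => M)) F

/-- An ultrafilter `u` on `ω` is `κ`-saturated if every ultrapower over `u` of a countable structure
(for a countable language) is `κ`-saturated. -/
def IsSaturatedUltrafilter (u : Ultrafilter ℕ) (κ : Cardinal.{0}) : Prop :=
  ∀ (L : FirstOrder.Language.{0, 0}) [Countable L.Symbols] (M : Type) [L.Structure M] [Countable M]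
    [Nonempty M], IsSaturated L (Ultrapower u M) κ

/-! ### Bounded lattices as first-order structures -/

/-- The constants `0` and `1` and the binary operations of the language of bounded lattices. -/
inductive LatticeFunctions : ℕ → Type
  | bot : LatticeFunctions 0
  | top : LatticeFunctions 0
  | sup : LatticeFunctions 2
  | inf : LatticeFunctions 2

/-- The first-order language of bounded lattices. -/
def latticeLanguage : FirstOrder.Language.{0, 0} :=
  ⟨LatticeFunctions, fun _ => Empty⟩

/-- A bounded lattice is a structure for the language of bounded lattices. -/
instance latticeStructure (α : Type*) [Lattice α] [BoundedOrder α] :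
    latticeLanguage.Structure α where
  funMap := fun {_} f =>
    match f with
    | .bot => fun _ => ⊥
    | .top => fun _ => ⊤
    | .sup => fun x => x 0 ⊔ x 1
    | .inf => fun x => x 0 ⊓ x 1
  RelMap := fun {_} r => r.elim

/-! ### Weight and bases for the closed sets -/

/-- The weight of a space: the least cardinality of a base for its open sets. -/
noncomputable def weight (X : Type v) [TopologicalSpace X] : Cardinal.{v} :=
  sInf {κ | ∃ B : Set (Set X), IsTopologicalBasis B ∧ #B = κ}

/-- A family is a base for the closed sets if the complements of its members form a base for the
open sets. -/
def IsClosedBase {X : Type*} [TopologicalSpace X] (B : Set (Set X)) : Prop :=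
  IsTopologicalBasis (compl '' B)

/-! ### The lattice of finite unions of closed intervals with rational end points -/

/-- A point of `[0,1]` that is a rational number. -/
def IsRationalPoint (x : unitInterval) : Prop := ∃ q : ℚ, (q : ℝ) = x

/-- The lattice of all finite unions of closed intervals `[a,b]` in `[0,1]` with rational end points
(one-point intervals `[a,a]` and the empty union are allowed). -/
def rationalUnions : Sublattice (Set unitInterval) where
  carrier := {A | ∃ T : Set (unitInterval × unitInterval), T.Finite ∧
    (∀ p ∈ T, IsRationalPoint p.1 ∧ IsRationalPoint p.2) ∧ A = ⋃ p ∈ T, Icc p.1 p.2}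
  supClosed' := by
    rintro _ ⟨S, hS, hS', rfl⟩ _ ⟨T, hT, hT', rfl⟩
    refine ⟨S ∪ T, hS.union hT, ?_, ?_⟩
    · rintro p (hp | hp)
      · exact hS' p hp
      · exact hT' p hp
    · rw [biUnion_union]; rfl
  infClosed' := by
    rintro _ ⟨S, hS, hS', rfl⟩ _ ⟨T, hT, hT', rfl⟩
    refine ⟨(fun r : (unitInterval × unitInterval) × (unitInterval × unitInterval) =>
      (r.1.1 ⊔ r.2.1, r.1.2 ⊓ r.2.2)) '' (S ×ˢ T), (hS.prod hT).image _, ?_, ?_⟩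
    · rintro _ ⟨⟨p, q⟩, ⟨hp, hq⟩, rfl⟩
      constructor
      · rcases le_total p.1 q.1 with h | h
        · simpa [sup_eq_right.2 h] using (hT' q hq).1
        · simpa [sup_eq_left.2 h] using (hS' p hp).1
      · rcases le_total p.2 q.2 with h | h
        · simpa [inf_eq_left.2 h] using (hS' p hp).2
        · simpa [inf_eq_right.2 h] using (hT' q hq).2
    · ext x
      simp only [inf_eq_inter, mem_inter_iff, mem_iUnion, mem_image, mem_prod, Prod.exists,
        mem_Icc, exists_prop]
      constructor
      · rintro ⟨⟨a, b, h, hx⟩, ⟨c, d, h', hx'⟩⟩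
        exact ⟨_, _, ⟨a, b, c, d, ⟨h, h'⟩, rfl⟩, sup_le hx.1 hx'.1, le_inf hx.2 hx'.2⟩
      · rintro ⟨_, _, ⟨a, b, c, d, ⟨h, h'⟩, e⟩, hx, hx'⟩
        obtain ⟨rfl, rfl⟩ := Prod.mk.inj e
        exact ⟨⟨a, b, h, le_sup_left.trans hx, hx'.trans inf_le_left⟩,
          ⟨c, d, h', le_sup_right.trans hx, hx'.trans inf_le_right⟩⟩

/-- The least element is the empty set and the greatest element is `[0,1]`. -/
instance : BoundedOrder rationalUnions where
  bot := ⟨∅, ∅, finite_empty, by simp, by simp⟩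
  bot_le A := empty_subset A.1
  top := ⟨univ, {(0, 1)}, finite_singleton _, by
    rintro _ rfl
    exact ⟨⟨0, by simp⟩, ⟨1, by simp⟩⟩, by
    ext x
    simpa using (unitInterval.le_one' : x ≤ 1)⟩
  le_top A := subset_univ A.1

/-! ### The continua `𝕀ᵤ` -/

/-- The space `ω × [0,1]`, with `ω` discrete. -/
abbrev StripSpace : Type := ℕ × unitInterval

/-- The remainder `βX \ X` of the space `X = ω × [0,1]`. -/
def remainder : Set (StoneCech StripSpace) :=
  (range (stoneCechUnit : StripSpace → StoneCech StripSpace))ᶜ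

/-- The set `𝕀ᵤ`: the intersection of the closures in `β(ω × [0,1])` of the sets `U × [0,1]`, where
`U` runs through `u`. -/
def standardSet (u : Ultrafilter ℕ) : Set (StoneCech StripSpace) :=
  ⋂ U ∈ u, closure (stoneCechUnit '' (U ×ˢ (univ : Set unitInterval)))

/-- The trace on `𝕀ᵤ` of the closure of the set `⋃ₙ {n} × Fₙ`. -/
def trace (u : Ultrafilter ℕ) (F : ℕ → rationalUnions) : Set (standardSet u) :=
  Subtype.val ⁻¹' closure (stoneCechUnit '' {z : StripSpace | z.2 ∈ (F z.1 : Set unitInterval)})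

end UniversalContinuum

/-!
The continuum `𝕀ᵤ` is studied through the lattice `𝓘^ω/u`, which embeds into the lattice of closed
subsets of `𝕀ᵤ` and forms a base there; universality is then a consequence of saturation.

*Topology.* Disjoint closed subsets of the normal space `ω × [0,1]` have disjoint closures in the
Čech–Stone compactification. Hence the closures of `U × [0,1]` are clopen, the trace of a closed set
on `𝕀ᵤ` depends only on its behaviour on `u`-many intervals, and inclusion of traces is inclusion on
`u`-many intervals (`closure_subset_on_standardSet_iff`). This gives the embedding
(`traceEmbedding`). A separation of `𝕀ᵤ` would separate `u`-many of the intervals `{n} × [0,1]`, so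
`𝕀ᵤ` is connected; the clopen sets `cl (U × [0,1])` show that it is a component of the remainder.
The weight is at most `𝔠` by counting sequences. It is at least `𝔠`, since `𝔠` many eventually
different sequences select, from a countable disjoint family of open subsets of `[0,1]`, traces that
are pairwise disjoint nonempty open sets (`weight_standardSet`).

*Saturation.* For free `u` the ultrapower is `ℵ₁`-saturated by a diagonal argument
(`isSaturated_ultrapower_aleph_one`). A `κ`-saturated structure realizes every finitely satisfiable
set of formulas in at most `κ` variables (`IsSaturated.exists_realize_family`), which yields
`κ⁺`-universality and also drives the construction of the continuous images.

*Continuous images.* Let `S` be a finite family of closed sets in a continuum `K`. Join two points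
if, among the members of `S`, those containing one of the points are comparable with those
containing the other. As `K` is connected, so is this graph (`typeGraph_preconnected`), and a walk through
finitely many points of `K` can be laid out along `[0,1]`: send `F ∈ S` to the union of those
consecutive intervals whose vertex lies in `F`. Comparability of consecutive vertices makes this map
respect intersections (`exists_finite_representation`). By saturation these finite approximations
produce a representation of a whole base for the closed sets of `K`, of size at most `κ`, by closed
subsets of `𝕀ᵤ`, and as in Wallman duality such a representation is induced by a continuous
surjection `𝕀ᵤ → K` (`exists_continuous_surjective_of_representation`).
-/

namespace UniversalContinuum

open FirstOrder.Language FirstOrder.Language.Structure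

/-! ### Realizing types in saturated structures -/

/-- Every formula has only finitely many free variables. -/
theorem exists_formula_fin (L : FirstOrder.Language.{0, 0}) {ι : Type} (φ : L.Formula ι) :
    ∃ (n : ℕ) (a : Fin n → ι) (ψ : L.Formula (Fin n)), Function.Injective a ∧
      ∀ (M : Type) [L.Structure M] (v : ι → M), φ.Realize v ↔ ψ.Realize (v ∘ a) := by
  classical
  let e := Fintype.equivFin φ.freeVarFinset
  refine ⟨_, fun k => (e.symm k : ι), BoundedFormula.restrictFreeVar φ e,
    Subtype.val_injective.comp e.symm.injective, fun M _ v => ?_⟩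
  refine (BoundedFormula.realize_restrictFreeVar v fun a => ?_).symm
  simp

section Realize

variable {L : FirstOrder.Language.{0, 0}} {M : Type} [L.Structure M]

theorem realize_constantsVarsEquiv_symm {α : Type} {A : Set M} (ψ : L.Formula (A ⊕ α)) (x : α → M) :
    Formula.Realize (BoundedFormula.constantsVarsEquiv.symm ψ : L[[A]].Formula α) x ↔
      ψ.Realize (Sum.elim (fun a => (a : M)) x) := by
  have := BoundedFormula.realize_constantsVarsEquiv (L := L)
    (φ := (BoundedFormula.constantsVarsEquiv.symm ψ : L[[A]].Formula α)) (v := x)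
    (xs := (default : Fin 0 → M))
  rw [Equiv.apply_symm_apply] at this
  exact this.symm

/-- Saturation for types whose parameters are given by a family rather than by a set. -/
theorem IsSaturated.exists_realize {κ : Cardinal.{0}} (hM : IsSaturated L M κ) {S : Type}
    (hS : #S < κ) (g : S → M) (p : Set (L.Formula (S ⊕ Fin 1)))
    (hp : ∀ Δ ⊆ p, Δ.Finite → ∃ x : M, ∀ ψ ∈ Δ, ψ.Realize (Sum.elim g fun _ => x)) :
    ∃ x : M, ∀ ψ ∈ p, ψ.Realize (Sum.elim g fun _ => x) := by
  let T : L.Formula (S ⊕ Fin 1) → L[[range g]].Formula (Fin 1) := fun ψ =>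
    BoundedFormula.constantsVarsEquiv.symm (ψ.relabel (Sum.map (rangeFactorization g) id))
  have hT (ψ : L.Formula (S ⊕ Fin 1)) (x : M) :
      (T ψ).Realize (fun _ => x) ↔ ψ.Realize (Sum.elim g fun _ => x) := by
    rw [realize_constantsVarsEquiv_symm, Formula.realize_relabel]
    refine iff_of_eq (congrArg _ ?_)
    ext (s | k) <;> rfl
  obtain ⟨x, hx⟩ := hM (range g) (Cardinal.mk_range_le.trans_lt hS) (T '' p) (by
    intro Δ hΔ hfin
    obtain ⟨Δ', hΔ', hfin', rfl⟩ := exists_subset_image_finite_and.1 ⟨Δ, hΔ, hfin, rfl⟩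
    obtain ⟨x, hx⟩ := hp Δ' hΔ' hfin'
    exact ⟨x, by rintro _ ⟨ψ, hψ, rfl⟩; exact (hT ψ x).2 (hx ψ hψ)⟩)
  exact ⟨x, fun ψ hψ => (hT ψ x).1 (hx _ ⟨ψ, hψ, rfl⟩)⟩

/-- A saturated structure realizes finitely satisfiable sets of formulas in as many variables as its
degree of saturation. An ultrafilter on the assignments completes the given set; the values of the
variables are then chosen by recursion along a well-order of least length. -/
theorem IsSaturated.exists_realize_family {κ : Cardinal.{0}} (hM : IsSaturated L M κ) {ι : Type}
    (hι : #ι ≤ κ) (p : Set (L.Formula ι))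
    (hp : ∀ Δ ⊆ p, Δ.Finite → ∃ v : ι → M, ∀ φ ∈ Δ, φ.Realize v) :
    ∃ v : ι → M, ∀ φ ∈ p, φ.Realize v := by
  classical
  obtain ⟨W, hW⟩ := Ultrafilter.exists_ultrafilter_of_finite_inter_nonempty
    ((fun φ : L.Formula ι => {v : ι → M | φ.Realize v}) '' p) (by
      intro T hT
      obtain ⟨Δ, hΔ, hfin, hT'⟩ := exists_subset_image_finite_and.1
        ⟨(T : Set (Set (ι → M))), hT, T.finite_toSet, rfl⟩
      obtain ⟨v, hv⟩ := hp Δ hΔ hfin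
      refine ⟨v, ?_⟩
      rw [hT']
      rintro _ ⟨φ, hφ, rfl⟩
      exact hv φ hφ)
  have hW' (φ : L.Formula ι) (hφ : φ ∈ p) : ∀ᶠ v in (W : Filter (ι → M)), φ.Realize v :=
    hW ⟨φ, hφ, rfl⟩
  obtain ⟨v₀⟩ : Nonempty (ι → M) := W.nonempty_of_mem univ_mem |>.to_type
  rcases isEmpty_or_nonempty ι with hι0 | ⟨⟨i₀⟩⟩
  · refine ⟨v₀, fun φ hφ => ?_⟩
    obtain ⟨v, hv⟩ := (hW' φ hφ).exists
    rwa [Subsingleton.elim v₀ v]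
  have : Nonempty M := ⟨v₀ i₀⟩
  obtain ⟨r, wo, hr⟩ := Cardinal.exists_ord_eq ι
  let _ : LinearOrder ι := linearOrderOfSTO r
  have : WellFoundedLT ι := ⟨wo.wf⟩
  have hcard (i : ι) : #(Iio i) < κ :=
    (Cardinal.card_typein_lt (r := r) i hr).trans_le hι
  -- `Q i h x`: the value `x` at `i` realizes the type that `W` prescribes over the values `h`
  -- chosen below `i`.
  let Q (i : ι) (h : Iio i → M) (x : M) : Prop := ∀ ψ : L.Formula (Iio i ⊕ Fin 1),
    (∀ᶠ v in (W : Filter (ι → M)), ψ.Realize (Sum.elim (fun j => v j) fun _ => v i)) →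
      ψ.Realize (Sum.elim h fun _ => x)
  let g : ι → M := (wellFounded_lt (α := ι)).fix fun i h =>
    Classical.epsilon (Q i fun j => h j j.2)
  have hg (i : ι) : g i = Classical.epsilon (Q i fun j => g j) :=
    (wellFounded_lt (α := ι)).fix_eq _ i
  have key (i : ι) : ∀ (n : ℕ) (a : Fin n → ι) (φ : L.Formula (Fin n)), (∀ k, a k ≤ i) →
      (∀ᶠ v in (W : Filter (ι → M)), φ.Realize (v ∘ a)) → φ.Realize (g ∘ a) := by
    induction i using (wellFounded_lt (α := ι)).induction with | _ i ih =>
    have hlt : ∀ (n : ℕ) (a : Fin n → ι) (φ : L.Formula (Fin n)), (∀ k, a k < i) →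
        (∀ᶠ v in (W : Filter (ι → M)), φ.Realize (v ∘ a)) → φ.Realize (g ∘ a) := by
      intro n a φ ha hφ
      rcases n with _ | n
      · obtain ⟨v, hv⟩ := hφ.exists
        rwa [Subsingleton.elim (g ∘ a) (v ∘ a)]
      · obtain ⟨k, -, hk⟩ := Finset.exists_max_image Finset.univ a ⟨0, Finset.mem_univ _⟩
        exact ih (a k) (ha k) _ a φ (fun l => hk l (Finset.mem_univ l)) hφ
    have hex : ∃ x, Q i (fun j => g j) x := by
      obtain ⟨x, hx⟩ := hM.exists_realize (hcard i) (fun j => g j)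
        {ψ | ∀ᶠ v in (W : Filter (ι → M)), ψ.Realize (Sum.elim (fun j => v j) fun _ => v i)} (by
          intro Δ hΔ hfin
          have := hfin.to_subtype
          obtain ⟨n, a, χ, -, hχ⟩ := exists_formula_fin L
            (Formula.iExs (Fin 1) (Formula.iInf fun ψ : Δ => (ψ : L.Formula (Iio i ⊕ Fin 1))))
          have h1 := hlt n (fun k => a k) χ (fun k => (a k).2) (by
            have : ∀ᶠ v in (W : Filter (ι → M)), ∀ ψ : Δ,
                (ψ : L.Formula (Iio i ⊕ Fin 1)).Realize (Sum.elim (fun j => v j) fun _ => v i) :=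
              eventually_all.2 fun ψ => hΔ ψ.2
            filter_upwards [this] with v hv
            refine (hχ M fun j => v j).1 ?_
            rw [Formula.realize_iExs]
            exact ⟨fun _ => v i, Formula.realize_iInf.2 hv⟩)
          have h2 := (hχ M fun j => g j).2 h1
          rw [Formula.realize_iExs] at h2
          obtain ⟨y, hy⟩ := h2
          refine ⟨y 0, fun ψ hψ => ?_⟩
          have := Formula.realize_iInf.1 hy ⟨ψ, hψ⟩
          convert this using 3 with k
          rw [Subsingleton.elim k 0])
      exact ⟨x, fun ψ hψ => hx ψ hψ⟩
    have hgi : Q i (fun j => g j) (g i) := by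
      rw [hg i]
      exact Classical.epsilon_spec hex
    intro n a φ ha hφ
    let b : Fin n → Iio i ⊕ Fin 1 := fun k => if h : a k < i then .inl ⟨a k, h⟩ else .inr 0
    have hb (v : ι → M) : (Sum.elim (fun j : Iio i => v j) fun _ => v i) ∘ b = v ∘ a := by
      ext k
      by_cases h : a k < i
      · simp [b, h]
      · simp [b, le_antisymm (ha k) (not_lt.1 h)]
    have := hgi (φ.relabel b) (by
      filter_upwards [hφ] with v hv
      rwa [Formula.realize_relabel, hb])
    rwa [Formula.realize_relabel, hb] at this
  refine ⟨g, fun φ hφ => ?_⟩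
  obtain ⟨n, a, χ, -, hχ⟩ := exists_formula_fin L φ
  rw [hχ]
  have hχW : ∀ᶠ v in (W : Filter (ι → M)), χ.Realize (v ∘ a) :=
    (hW' φ hφ).mono fun v hv => (hχ M v).1 hv
  rcases n with _ | n
  · obtain ⟨v, hv⟩ := hχW.exists
    rwa [Subsingleton.elim (g ∘ a) (v ∘ a)]
  · obtain ⟨k, -, hk⟩ := Finset.exists_max_image Finset.univ a ⟨0, Finset.mem_univ _⟩
    exact key (a k) _ a χ (fun l => hk l (Finset.mem_univ l)) hχW

/-- A `κ`-saturated structure is `κ⁺`-universal: it realizes the elementary diagram of each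
elementarily equivalent structure of size at most `κ`. -/
theorem IsSaturated.isUniversal {κ : Cardinal.{0}} (hM : IsSaturated L M κ) :
    IsUniversal L M (Order.succ κ) := by
  intro N _ _ hN hNM
  obtain ⟨v, hv⟩ := hM.exists_realize_family (Order.lt_succ_iff.1 hN)
    {φ : L.Formula N | φ.Realize id} (by
      intro Δ hΔ hfin
      have := hfin.to_subtype
      obtain ⟨n, a, χ, ha, hχ⟩ := exists_formula_fin L
        (Formula.iInf fun φ : Δ => (φ : L.Formula N))
      have h1 : χ.Realize a := (hχ N id).1 (Formula.realize_iInf.2 fun φ => hΔ φ.2)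
      let σ : L.Sentence := Formula.iExs (Fin n) (χ.relabel (Sum.inr : Fin n → Empty ⊕ Fin n))
      have hσ (P : Type) [L.Structure P] : P ⊨ σ ↔ ∃ y : Fin n → P, χ.Realize y := by
        simp only [σ, Sentence.Realize, Formula.realize_iExs, Formula.realize_relabel,
          Sum.elim_comp_inr]
      obtain ⟨y, hy⟩ := (hσ M).1 ((elementarilyEquivalent_iff.1 hNM σ).1 ((hσ N).2 ⟨a, h1⟩))
      have : Nonempty M := hNM.nonempty_iff.1 inferInstance
      refine ⟨Function.extend a y fun _ => Classical.arbitrary M, fun φ hφ => ?_⟩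
      refine Formula.realize_iInf.1 ((hχ M _).2 ?_) ⟨φ, hφ⟩
      rwa [show Function.extend a y (fun _ => Classical.arbitrary M) ∘ a = y from
        funext fun k => ha.extend_apply _ _ k])
  refine ⟨⟨v, fun n φ x => ?_⟩⟩
  by_cases h : φ.Realize x
  · have := hv (φ.relabel x) (by simpa [Formula.realize_relabel] using h)
    rw [Formula.realize_relabel] at this
    simp [h, this]
  · have := hv (φ.not.relabel x) (by
      simpa [Formula.realize_relabel, Formula.realize_not] using h)
    rw [Formula.realize_relabel, Formula.realize_not] at this
    simp [h, this]

end Realize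

/-! ### Ultrapowers over `ω` -/

theorem Ultrapower.mk_surjective (u : Ultrafilter ℕ) {M : Type} :
    Function.Surjective (Ultrapower.mk u : (ℕ → M) → Ultrapower u M) :=
  Quotient.mk_surjective

theorem Ultrapower.mk_eq_mk {u : Ultrafilter ℕ} {M : Type} {F G : ℕ → M} :
    Ultrapower.mk u F = Ultrapower.mk u G ↔ ∀ᶠ n in (u : Filter ℕ), F n = G n :=
  Quotient.eq''

theorem Ultrapower.realize_mk {L : FirstOrder.Language.{0, 0}} {M : Type} [L.Structure M]
    [Nonempty M] {u : Ultrafilter ℕ} {α : Type} (φ : L.Formula α) (x : α → ℕ → M) :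
    φ.Realize (fun i => Ultrapower.mk u (x i)) ↔
      ∀ᶠ n in (u : Filter ℕ), φ.Realize fun i => x i n :=
  Ultraproduct.realize_formula_cast φ x

/-- Ultrapowers over free ultrafilters on `ω` are `ℵ₁`-saturated: a type with countably many
formulas is realized by a diagonal sequence, which at `n` satisfies as many of the first `n`
formulas as the ultrafilter permits. -/
theorem isSaturated_ultrapower_aleph_one (L : FirstOrder.Language.{0, 0}) [Countable L.Symbols]
    (M : Type) [L.Structure M] [Nonempty M] (u : Ultrafilter ℕ)
    (hu : (u : Filter ℕ) ≤ cofinite) :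
    IsSaturated L (Ultrapower u M) (Cardinal.aleph 1) := by
  classical
  intro A hA p hp
  have hAc : Countable A := by
    rw [← Cardinal.mk_le_aleph0_iff, ← Order.lt_succ_iff, Cardinal.succ_aleph0]
    exact hA
  have hne : Nonempty (Ultrapower u M) := ⟨Ultrapower.mk u fun _ => Classical.arbitrary M⟩
  let T : L[[A]].Formula (Fin 1) → L.Formula (A ⊕ Fin 1) := BoundedFormula.constantsVarsEquiv
  choose r hr using fun a : A => Ultrapower.mk_surjective u (a : Ultrapower u M)
  -- The solutions of `φ` are described by the formula `T φ` and representatives of the parameters,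
  -- here evaluated at the coordinate `n`.
  let R (φ : L[[A]].Formula (Fin 1)) (n : ℕ) (y : M) : Prop :=
    (T φ).Realize (Sum.elim (fun a => r a n) fun _ => y)
  have hR (φ : L[[A]].Formula (Fin 1)) (y : ℕ → M) :
      φ.Realize (fun _ => Ultrapower.mk u y) ↔ ∀ᶠ n in (u : Filter ℕ), R φ n (y n) := by
    have h1 := realize_constantsVarsEquiv_symm (T φ) (fun _ : Fin 1 => Ultrapower.mk u y)
    rw [show (BoundedFormula.constantsVarsEquiv.symm (T φ) : L[[A]].Formula (Fin 1)) = φ from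
      Equiv.symm_apply_apply _ _] at h1
    have h2 := Ultrapower.realize_mk (u := u) (T φ) (Sum.elim r fun _ => y)
    have e1 : (fun i => Ultrapower.mk u (Sum.elim r (fun _ : Fin 1 => y) i)) =
        Sum.elim (fun a : A => (a : Ultrapower u M)) fun _ => Ultrapower.mk u y := by
      ext (a | k)
      · exact hr a
      · rfl
    have e2 (n : ℕ) : (fun i => Sum.elim r (fun _ : Fin 1 => y) i n) =
        Sum.elim (fun a => r a n) fun _ => y n := by
      ext (a | k) <;> rfl
    rw [e1] at h2
    simp only [e2] at h2
    exact h1.trans h2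
  rcases p.eq_empty_or_nonempty with rfl | hpne
  · exact ⟨Classical.choice hne, by simp⟩
  obtain ⟨e, he⟩ := (to_countable p).exists_eq_range hpne
  let V (k : ℕ) : Set ℕ := {n | ∃ y : M, ∀ i < k, R (e i) n y}
  have hV (k : ℕ) : V k ∈ u := by
    obtain ⟨x, hx⟩ := hp (e '' Iio k) (by rw [he]; exact image_subset_range _ _)
      ((finite_Iio k).image _)
    obtain ⟨y, rfl⟩ := Ultrapower.mk_surjective u x
    have : ∀ᶠ n in (u : Filter ℕ), ∀ i ∈ Iio k, R (e i) n (y n) :=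
      (eventually_all_finite (finite_Iio k)).2 fun i hi =>
        (hR _ y).1 (hx _ (mem_image_of_mem e hi))
    exact mem_of_superset this fun n hn => ⟨y n, hn⟩
  have hex (n : ℕ) : ∃ y : M, ∀ i < Nat.findGreatest (fun k => n ∈ V k) n, R (e i) n y :=
    Nat.findGreatest_spec (P := fun k => n ∈ V k) (Nat.zero_le n)
      ⟨Classical.arbitrary M, fun i hi => absurd hi (Nat.not_lt_zero i)⟩
  choose y hy using hex
  refine ⟨Ultrapower.mk u y, ?_⟩
  rw [he]
  rintro _ ⟨i, rfl⟩
  rw [hR]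
  have hfree : ∀ᶠ n in (u : Filter ℕ), i + 1 ≤ n :=
    hu (by rw [Nat.cofinite_eq_atTop]; exact eventually_ge_atTop (i + 1))
  filter_upwards [hV (i + 1), hfree] with n hn hin
  exact hy n i (Nat.le_findGreatest hin hn)

/-- For a principal ultrafilter the ultrapower of the pure set `ω` is `ω` itself, which omits the
type of an element different from all members of `ω`. -/
theorem IsSaturatedUltrafilter.le_cofinite {u : Ultrafilter ℕ}
    (hu : IsSaturatedUltrafilter u 𝔠) : (u : Filter ℕ) ≤ cofinite := by
  refine (Ultrafilter.le_cofinite_or_eq_pure u).resolve_right ?_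
  rintro ⟨m, hm⟩
  have hmem {P : ℕ → Prop} : (∀ᶠ n in (u : Filter ℕ), P n) ↔ P m := by
    rw [hm]; exact Iff.rfl
  let _ : Language.empty.Structure ℕ := Language.emptyStructure
  let g (k : ℕ) : Ultrapower u ℕ := Ultrapower.mk u fun _ => k
  let θ (k : ℕ) : Language.empty.Formula (ℕ ⊕ Fin 1) :=
    (Term.equal (.var (.inl k)) (.var (.inr 0))).not
  have hθ (k : ℕ) (x : Ultrapower u ℕ) :
      (θ k).Realize (Sum.elim g fun _ => x) ↔ g k ≠ x := by
    simp [θ, Formula.realize_not, Formula.realize_equal]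
  obtain ⟨x, hx⟩ := (hu Language.empty ℕ).exists_realize
    (by rw [Cardinal.mk_nat]; exact Cardinal.aleph0_lt_continuum) g (range θ) (by
      intro Δ hΔ hfin
      obtain ⟨s, -, hs, rfl⟩ := exists_subset_image_finite_and.1
        ⟨Δ, (by rwa [image_univ] : Δ ⊆ θ '' univ), hfin, rfl⟩
      obtain ⟨k, hk⟩ := hs.infinite_compl.nonempty
      refine ⟨g k, ?_⟩
      rintro _ ⟨l, hl, rfl⟩
      rw [hθ, Ne, Ultrapower.mk_eq_mk, hmem]
      rintro rfl
      exact hk hl)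
  obtain ⟨F, rfl⟩ := Ultrapower.mk_surjective u x
  exact (hθ (F m) _).1 (hx _ ⟨F m, rfl⟩) (Ultrapower.mk_eq_mk.2 (hmem.2 rfl))

/-! ### The lattice of finite unions of rational intervals -/

theorem rationalUnions_ext {A B : rationalUnions}
    (h : ∀ t, t ∈ (A : Set unitInterval) ↔ t ∈ (B : Set unitInterval)) : A = B :=
  Subtype.ext (Set.ext h)

theorem coe_bot_rationalUnions : ((⊥ : rationalUnions) : Set unitInterval) = ∅ := rfl

theorem coe_top_rationalUnions : ((⊤ : rationalUnions) : Set unitInterval) = univ := rfl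

theorem coe_sup_rationalUnions (A B : rationalUnions) :
    ((A ⊔ B : rationalUnions) : Set unitInterval) = (A : Set unitInterval) ∪ B := rfl

theorem coe_inf_rationalUnions (A B : rationalUnions) :
    ((A ⊓ B : rationalUnions) : Set unitInterval) = (A : Set unitInterval) ∩ B := rfl

theorem isClosed_coe_rationalUnions (A : rationalUnions) : IsClosed (A : Set unitInterval) := by
  obtain ⟨A, T, hT, -, rfl⟩ := A
  exact hT.isClosed_biUnion fun p _ => isClosed_Icc

instance : Countable rationalUnions := by
  have hQ : {x : unitInterval | IsRationalPoint x}.Countable := by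
    refine (countable_range fun q : ℚ => projIcc (0 : ℝ) 1 zero_le_one q).mono ?_
    rintro x ⟨q, hq⟩
    exact ⟨q, by simp only [hq]; exact projIcc_val zero_le_one x⟩
  have hc : (rationalUnions : Set (Set unitInterval)).Countable := by
    refine ((countable_ofPred_finite_subset (hQ.prod hQ)).image
      fun T => ⋃ p ∈ T, Icc p.1 p.2).mono ?_
    rintro _ ⟨T, hT, hT', rfl⟩
    exact ⟨T, ⟨hT, fun p hp => hT' p hp⟩, rfl⟩
  exact hc.to_subtype

/-! ### Finite families of closed subsets of a continuum -/

/-- Two points are adjacent if, among the members of `S`, those containing one of the points are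
comparable with those containing the other. -/
def typeGraph {K : Type v} (S : Set (Set K)) : SimpleGraph K :=
  SimpleGraph.fromRel fun x y => ∀ F ∈ S, x ∈ F → y ∈ F

theorem typeGraph_adj_of_le {K : Type v} {S : Set (Set K)} {x y : K} (hxy : x ≠ y)
    (h : ∀ F ∈ S, x ∈ F → y ∈ F) : (typeGraph S).Adj x y :=
  (SimpleGraph.fromRel_adj _ _ _).2 ⟨hxy, Or.inl h⟩

/-- Call the set of members of `S` that contain `x` the type of `x`. The points whose type includes
that of `x` form a closed set, and there are only finitely many types. So every union of components
of the graph is a finite union of closed sets, and hence clopen. -/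
theorem typeGraph_preconnected {K : Type v} [TopologicalSpace K] [PreconnectedSpace K]
    {S : Set (Set K)} (hS : S.Finite) (hc : ∀ F ∈ S, IsClosed F) :
    (typeGraph S).Preconnected := by
  classical
  let up (T : Set (Set K)) : Set K := {y | ∀ F ∈ T, y ∈ F}
  let ty (x : K) : Set (Set K) := {F ∈ S | x ∈ F}
  have hup (x : K) : IsClosed (up (ty x)) := by
    have : up (ty x) = ⋂ F ∈ ty x, F := by ext; simp [up]
    rw [this]
    exact isClosed_biInter fun F hF => hc F hF.1
  have hreach (x y : K) (h : y ∈ up (ty x)) : (typeGraph S).Reachable x y := by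
    by_cases hxy : x = y
    · exact hxy ▸ SimpleGraph.Reachable.refl x
    · exact (typeGraph_adj_of_le hxy fun F hF hx => h F ⟨hF, hx⟩).reachable
  have hself (x : K) : x ∈ up (ty x) := fun F hF => hF.2
  have hclosed (P : Set K) (hP : ∀ x ∈ P, ∀ y, (typeGraph S).Reachable x y → y ∈ P) :
      IsClosed P := by
    have : P = ⋃ T ∈ ty '' P, up T := by
      ext y
      simp only [mem_iUnion, exists_prop, exists_mem_image]
      exact ⟨fun hy => ⟨y, hy, hself y⟩, fun ⟨x, hx, hxy⟩ => hP x hx y (hreach x y hxy)⟩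
    rw [this]
    refine Set.Finite.isClosed_biUnion (hS.finite_subsets.subset ?_) ?_
    · rintro _ ⟨x, -, rfl⟩
      exact sep_subset _ _
    · rintro _ ⟨x, -, rfl⟩
      exact hup x
  intro x y
  let P : Set K := {z | (typeGraph S).Reachable x z}
  have hclopen : IsClopen P := by
    refine ⟨hclosed P fun a ha b hab => SimpleGraph.Reachable.trans ha hab, ?_⟩
    rw [← isClosed_compl_iff]
    exact hclosed _ fun a ha b hab hb => ha (SimpleGraph.Reachable.trans hb hab.symm)
  have := hclopen.eq_univ ⟨x, SimpleGraph.Reachable.refl x⟩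
  exact this.ge (mem_univ y)

theorem exists_walk_of_finite {K : Type v} [Nonempty K] {G : SimpleGraph K} (hG : G.Preconnected)
    {D : Set K} (hD : D.Finite) : ∃ (a b : K) (w : G.Walk a b), ∀ d ∈ D, d ∈ w.support := by
  induction D, hD using Set.Finite.induction_on with
  | empty => exact ⟨Classical.arbitrary K, _, .nil, by simp⟩
  | @insert d D _ _ ih =>
    obtain ⟨a, b, w, hw⟩ := ih
    obtain ⟨w'⟩ := hG b d
    refine ⟨a, d, w.append w', ?_⟩
    simp only [SimpleGraph.Walk.mem_support_append_iff]
    rintro e (rfl | he)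
    · exact .inr w'.end_mem_support
    · exact .inl (hw e he)

/-- The union of those intervals `[j/(N+1), (j+1)/(N+1)]`, `j ≤ N`, for which `x j` lies in `F`. -/
def pathTrace {K : Type v} (N : ℕ) (x : ℕ → K) (F : Set K) : Set unitInterval :=
  {t | ∃ j ≤ N, x j ∈ F ∧ (j : ℝ) ≤ (t : ℝ) * (N + 1) ∧ (t : ℝ) * (N + 1) ≤ j + 1}

theorem pathTrace_mem {K : Type v} (N : ℕ) (x : ℕ → K) (F : Set K) :
    pathTrace N x F ∈ rationalUnions := by
  have hN : (0 : ℝ) < N + 1 := by positivity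
  let c (j : ℕ) : unitInterval := projIcc (0 : ℝ) 1 zero_le_one (j / (N + 1))
  have hc {j : ℕ} (hj : j ≤ N + 1) : (c j : ℝ) = j / (N + 1) := by
    have h1 : (j : ℝ) ≤ N + 1 := by exact_mod_cast hj
    have h2 : (j : ℝ) / (N + 1) ∈ Icc (0 : ℝ) 1 := ⟨by positivity, (div_le_one hN).2 h1⟩
    simp only [c, projIcc_of_mem zero_le_one h2]
  have hr {j : ℕ} (hj : j ≤ N + 1) : IsRationalPoint (c j) :=
    ⟨j / (N + 1), by rw [hc hj]; push_cast; rfl⟩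
  refine ⟨(fun j => (c j, c (j + 1))) '' {j | j ≤ N ∧ x j ∈ F},
    ((finite_Iic N).subset fun j hj => hj.1).image _, ?_, ?_⟩
  · rintro _ ⟨j, ⟨hj, -⟩, rfl⟩
    exact ⟨hr (by omega), hr (by omega)⟩
  · ext t
    simp only [pathTrace, mem_ofPred_eq, biUnion_image, mem_iUnion, mem_Icc, exists_prop,
      ← Subtype.coe_le_coe]
    refine exists_congr fun j => ?_
    rw [← and_assoc]
    refine and_congr_right fun ⟨hj, _⟩ => ?_
    rw [hc (by omega), hc (by omega), div_le_iff₀ hN, le_div_iff₀ hN]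
    push_cast
    rfl

/-- `f` represents the members of `S` by finite unions of rational intervals so that unions,
intersections, the empty set, the whole space and nonemptiness are respected. -/
structure IsRepresentation {K : Type v} (S : Set (Set K)) (f : Set K → rationalUnions) : Prop where
  empty : f ∅ = ⊥
  univ : f univ = ⊤
  ne_bot : ∀ F ∈ S, F.Nonempty → f F ≠ ⊥
  union : ∀ F G, f (F ∪ G) = f F ⊔ f G
  inter : ∀ F ∈ S, ∀ G ∈ S, f (F ∩ G) = f F ⊓ f G

theorem IsRepresentation.mono {K : Type v} {S T : Set (Set K)} {f : Set K → rationalUnions}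
    (hf : IsRepresentation T f) (h : S ⊆ T) : IsRepresentation S f :=
  ⟨hf.empty, hf.univ, fun F hF => hf.ne_bot F (h hF), hf.union,
    fun F hF G hG => hf.inter F (h hF) G (h hG)⟩

/-- Walk in `typeGraph S` through a point of each nonempty member of `S`, lay the vertices of the
walk out along `[0,1]` as consecutive intervals, and represent `F` by the intervals whose vertex lies in
`F`. Intervals with a common point belong to equal or consecutive vertices, and one of two
consecutive vertices lies in all members of `S` that contain either; hence intersections are
respected. -/
theorem exists_finite_representation {K : Type v} [TopologicalSpace K] [ConnectedSpace K]
    {S : Set (Set K)} (hS : S.Finite) (hc : ∀ F ∈ S, IsClosed F) :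
    ∃ f : Set K → rationalUnions, IsRepresentation S f := by
  classical
  obtain ⟨D, hD, hDS⟩ : ∃ D : Set K, D.Finite ∧ ∀ F ∈ S, F.Nonempty → ∃ d ∈ D, d ∈ F := by
    refine ⟨(fun F => Classical.epsilon fun d => d ∈ F) '' S, hS.image _, fun F hF hne => ?_⟩
    exact ⟨_, mem_image_of_mem _ hF, Classical.epsilon_spec hne⟩
  obtain ⟨a, b, w, hw⟩ := exists_walk_of_finite (typeGraph_preconnected hS hc) hD
  have hstep (j : ℕ) : (∀ F ∈ S, w.getVert j ∈ F → w.getVert (j + 1) ∈ F) ∨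
      ∀ F ∈ S, w.getVert (j + 1) ∈ F → w.getVert j ∈ F := by
    rcases lt_or_ge j w.length with hj | hj
    · exact ((SimpleGraph.fromRel_adj _ _ _).1 (w.adj_getVert_succ hj)).2
    · rw [w.getVert_of_length_le hj, w.getVert_of_length_le (by omega)]
      exact .inl fun _ _ h => h
  have hN : (0 : ℝ) < w.length + 1 := by positivity
  refine ⟨fun F => ⟨_, pathTrace_mem w.length w.getVert F⟩, ?_, ?_, ?_, ?_, ?_⟩
  · refine rationalUnions_ext fun t => ?_
    simp [pathTrace, coe_bot_rationalUnions]
  · refine rationalUnions_ext fun t => ?_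
    simp only [pathTrace, coe_top_rationalUnions, mem_univ, iff_true, mem_ofPred_eq, true_and]
    have h0 : 0 ≤ (t : ℝ) * (w.length + 1) := mul_nonneg t.2.1 hN.le
    -- The right end point belongs to the last interval although its floor is too large.
    rcases le_or_gt ⌊(t : ℝ) * (w.length + 1)⌋₊ w.length with h | h
    · exact ⟨_, h, Nat.floor_le h0, (Nat.lt_floor_add_one _).le⟩
    · refine ⟨w.length, le_rfl, ?_, by nlinarith [t.2.2]⟩
      exact le_trans (by exact_mod_cast h.le) (Nat.floor_le h0)
  · intro F hF hne h
    obtain ⟨d, hd, hdF⟩ := hDS F hF hne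
    obtain ⟨j, rfl, hj⟩ := SimpleGraph.Walk.mem_support_iff_exists_getVert.1 (hw d hd)
    have hj' : (j : ℝ) ≤ w.length + 1 := by exact_mod_cast (by omega : j ≤ w.length + 1)
    have : (⟨j / (w.length + 1), by positivity, (div_le_one hN).2 hj'⟩ : unitInterval) ∈
        pathTrace w.length w.getVert F := by
      refine ⟨j, hj, hdF, ?_⟩
      simp only [div_mul_cancel₀ _ hN.ne']
      exact ⟨le_rfl, by linarith⟩
    rw [show pathTrace w.length w.getVert F = ∅ from congrArg Subtype.val h] at this
    exact this
  · intro F G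
    refine rationalUnions_ext fun t => ?_
    simp only [pathTrace, coe_sup_rationalUnions, mem_union, mem_ofPred_eq, ← exists_or]
    exact exists_congr fun j => by tauto
  · intro F hF G hG
    refine rationalUnions_ext fun t => ?_
    simp only [pathTrace, coe_inf_rationalUnions, mem_inter_iff, mem_ofPred_eq]
    constructor
    · rintro ⟨j, hj, ⟨hjF, hjG⟩, h⟩
      exact ⟨⟨j, hj, hjF, h⟩, ⟨j, hj, hjG, h⟩⟩
    · rintro ⟨⟨j, hj, hjF, h1, h2⟩, ⟨k, hk, hkG, h3, h4⟩⟩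
      have hjk : j ≤ k + 1 := by exact_mod_cast h1.trans h4
      have hkj : k ≤ j + 1 := by exact_mod_cast h3.trans h2
      obtain rfl | rfl | rfl : j = k ∨ k = j + 1 ∨ j = k + 1 := by omega
      · exact ⟨j, hj, ⟨hjF, hkG⟩, h1, h2⟩
      · rcases hstep j with hs | hs
        · exact ⟨j + 1, hk, ⟨hs F hF hjF, hkG⟩, h3, h4⟩
        · exact ⟨j, hj, ⟨hjF, hs G hG hkG⟩, h1, h2⟩
      · rcases hstep k with hs | hs
        · exact ⟨k + 1, hj, ⟨hjF, hs G hG hkG⟩, h1, h2⟩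
        · exact ⟨k, hk, ⟨hs F hF hjF, hkG⟩, h3, h4⟩

/-! ### The language of bounded lattices -/

instance : Countable latticeLanguage.Symbols := by
  have h1 (n : ℕ) : Finite (latticeLanguage.Functions n) := by
    change Finite (LatticeFunctions n)
    match n with
    | 0 => exact Set.finite_univ_iff.1 ((Set.toFinite {.bot, .top}).subset fun f _ => by
        cases f <;> simp)
    | 1 => exact @Finite.of_subsingleton _ ⟨fun f => nomatch f⟩
    | 2 => exact Set.finite_univ_iff.1 ((Set.toFinite {.sup, .inf}).subset fun f _ => by
        cases f <;> simp)
    | n + 3 => exact @Finite.of_subsingleton _ ⟨fun f => nomatch f⟩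
  have h2 (n : ℕ) : IsEmpty (latticeLanguage.Relations n) := inferInstanceAs (IsEmpty Empty)
  unfold FirstOrder.Language.Symbols
  infer_instance

section Symbols

/-- The constant `0`. -/
def botSymbol : latticeLanguage.Functions 0 := LatticeFunctions.bot
/-- The constant `1`. -/
def topSymbol : latticeLanguage.Functions 0 := LatticeFunctions.top
/-- The symbol `∨`. -/
def supSymbol : latticeLanguage.Functions 2 := LatticeFunctions.sup
/-- The symbol `∧`. -/
def infSymbol : latticeLanguage.Functions 2 := LatticeFunctions.inf

variable {α : Type v} [Lattice α] [BoundedOrder α]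

theorem funMap_botSymbol (x : Fin 0 → α) : funMap botSymbol x = ⊥ := rfl
theorem funMap_topSymbol (x : Fin 0 → α) : funMap topSymbol x = ⊤ := rfl
theorem funMap_supSymbol (x : Fin 2 → α) : funMap supSymbol x = x 0 ⊔ x 1 := rfl
theorem funMap_infSymbol (x : Fin 2 → α) : funMap infSymbol x = x 0 ⊓ x 1 := rfl

end Symbols

/-! ### Continuous images from saturation -/

/-- By saturation, the finite representations of closed sets of a continuum fit together to a
representation of a whole family of closed sets in the ultrapower, and hence in every lattice that
contains the ultrapower. -/
theorem exists_representation_of_isSaturated {u : Ultrafilter ℕ} {κ : Cardinal.{0}}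
    (hu : IsSaturated latticeLanguage (Ultrapower u rationalUnions) κ)
    {α : Type} [Lattice α] [BoundedOrder α]
    (e : Ultrapower u rationalUnions ↪[latticeLanguage] α)
    {K : Type v} [TopologicalSpace K] [ConnectedSpace K] {ι : Type} (hι : #ι ≤ κ)
    (C : ι → Set K) (hC : ∀ i, IsClosed (C i)) :
    ∃ ψ : ι → α, (∀ i, C i = ∅ → ψ i = ⊥) ∧ (∀ i, (C i).Nonempty → ψ i ≠ ⊥) ∧
      (∀ i j, C i ∪ C j = univ → ψ i ⊔ ψ j = ⊤) ∧
      ∀ i j k, C k = C i ∩ C j → ψ k = ψ i ⊓ ψ j := by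
  -- `p` consists of the formulas that hold in all sufficiently accurate finite representations.
  let p : Set (latticeLanguage.Formula ι) := {φ | ∃ T : Set (Set K), T.Finite ∧
    (∀ F ∈ T, IsClosed F) ∧ ∀ f : Set K → rationalUnions, IsRepresentation T f →
      φ.Realize fun i => f (C i)}
  obtain ⟨v, hv⟩ := hu.exists_realize_family hι p (by
    intro Δ hΔ hfin
    have : ∀ φ : latticeLanguage.Formula ι, ∃ T : Set (Set K), φ ∈ Δ → T.Finite ∧
        (∀ F ∈ T, IsClosed F) ∧ ∀ f : Set K → rationalUnions, IsRepresentation T f →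
          φ.Realize fun i => f (C i) := fun φ => by
      by_cases h : φ ∈ Δ
      · obtain ⟨T, hT⟩ := hΔ h
        exact ⟨T, fun _ => hT⟩
      · exact ⟨∅, fun h' => absurd h' h⟩
    choose T hT using this
    obtain ⟨f, hf⟩ := exists_finite_representation
      (S := ⋃ φ ∈ Δ, T φ) (hfin.biUnion fun φ hφ => (hT φ hφ).1) (by
        intro F hF
        obtain ⟨φ, hφ, hF⟩ := mem_iUnion₂.1 hF
        exact (hT φ hφ).2.1 F hF)
    refine ⟨fun i => Ultrapower.mk u fun _ => f (C i), fun φ hφ => ?_⟩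
    rw [Ultrapower.realize_mk φ fun i _ => f (C i)]
    exact Eventually.of_forall fun _ =>
      (hT φ hφ).2.2 f (hf.mono (subset_biUnion_of_mem (u := T) hφ)))
  have hfin2 (F G : Set K) : ({F, G} : Set (Set K)).Finite := by simp
  have hclosed2 (i j : ι) : ∀ F ∈ ({C i, C j} : Set (Set K)), IsClosed F := by
    rintro F (rfl | rfl)
    exacts [hC i, hC j]
  refine ⟨fun i => e (v i), fun i hi => ?_, fun i hi h => ?_, fun i j hij => ?_,
    fun i j k hk => ?_⟩
  · have h := hv (Term.equal (.var i) (.func botSymbol Fin.elim0))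
      ⟨∅, finite_empty, by simp, fun f hf => by
        rw [Formula.realize_equal]
        simp only [Term.realize, funMap_botSymbol, hi, hf.empty]⟩
    rw [Formula.realize_equal] at h
    simp only [Term.realize] at h
    beta_reduce
    rw [h, e.map_fun, funMap_botSymbol]
  · have h' := hv (Term.equal (.var i) (.func botSymbol Fin.elim0)).not
      ⟨{C i, C i}, hfin2 _ _, hclosed2 _ _, fun f hf => by
        rw [Formula.realize_not, Formula.realize_equal]
        simp only [Term.realize, funMap_botSymbol]
        exact hf.ne_bot _ (by simp) hi⟩
    rw [Formula.realize_not, Formula.realize_equal] at h'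
    refine h' (e.injective ?_)
    simp only [Term.realize]
    rw [e.map_fun, funMap_botSymbol]
    exact h
  · have h := hv (Term.equal (.func supSymbol ![.var i, .var j]) (.func topSymbol Fin.elim0))
      ⟨∅, finite_empty, by simp, fun f hf => by
        rw [Formula.realize_equal]
        simp only [Term.realize, funMap_supSymbol, funMap_topSymbol]
        simpa [← hf.union, hij] using hf.univ⟩
    rw [Formula.realize_equal] at h
    simp only [Term.realize] at h
    have h := congrArg e h
    rw [e.map_fun, e.map_fun, funMap_supSymbol, funMap_topSymbol] at h
    exact h
  · have h := hv (Term.equal (.func infSymbol ![.var i, .var j]) (.var k))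
      ⟨{C i, C j}, hfin2 _ _, hclosed2 _ _, fun f hf => by
        rw [Formula.realize_equal]
        simp only [Term.realize, funMap_infSymbol]
        rw [hk, hf.inter _ (by simp) _ (by simp)]
        rfl⟩
    rw [Formula.realize_equal] at h
    simp only [Term.realize] at h
    beta_reduce
    rw [← h, e.map_fun, funMap_infSymbol]
    rfl

/-- A representation of a base of closed sets of `K` by closed sets of `Z` is induced by a
continuous map of `Z` onto `K`: the image of `z` is the only point in all sets `C i` with
`z ∈ ψ i`. -/
theorem exists_continuous_surjective_of_representation {Z : Type*} [TopologicalSpace Z]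
    [CompactSpace Z] {K : Type v} [TopologicalSpace K] [CompactSpace K] [T2Space K]
    {ι : Type*} (C : ι → Set K) (hC : ∀ i, IsClosed (C i)) (huniv : ∃ i, C i = univ)
    (hinter : ∀ i j, ∃ k, C k = C i ∩ C j)
    (hbase : ∀ x O, IsOpen O → x ∈ O → ∃ i j, C i ∪ C j = univ ∧ x ∉ C i ∧ C j ⊆ O)
    (ψ : ι → Closeds Z) (h_empty : ∀ i, C i = ∅ → ψ i = ⊥)
    (h_nonempty : ∀ i, (C i).Nonempty → ψ i ≠ ⊥)
    (h_union : ∀ i j, C i ∪ C j = univ → ψ i ⊔ ψ j = ⊤)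
    (h_inter : ∀ i j k, C k = C i ∩ C j → ψ k = ψ i ⊓ ψ j) :
    ∃ f : Z → K, Continuous f ∧ Function.Surjective f := by
  obtain ⟨i₀, hi₀⟩ := huniv
  have hcover {i j : ι} (h : C i ∪ C j = univ) (z : Z) : z ∈ ψ i ∨ z ∈ ψ j := by
    have : z ∈ ψ i ⊔ ψ j := by rw [h_union i j h]; trivial
    exact this
  have hmem_inter {i j k : ι} (h : C k = C i ∩ C j) (z : Z) :
      z ∈ ψ k ↔ z ∈ ψ i ∧ z ∈ ψ j := by
    rw [h_inter i j k h]; exact Iff.rfl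
  have hz₀ (z : Z) : z ∈ ψ i₀ := by
    simpa using hcover (i := i₀) (j := i₀) (by simp [hi₀]) z
  have hex (z : Z) : ∃ x : K, ∀ i, z ∈ ψ i → x ∈ C i := by
    have : Nonempty {i // z ∈ ψ i} := ⟨⟨i₀, hz₀ z⟩⟩
    obtain ⟨x, hx⟩ := IsCompact.nonempty_iInter_of_directed_nonempty_isCompact_isClosed
      (fun i : {i // z ∈ ψ i} => C i) (by
        rintro ⟨i, hi⟩ ⟨j, hj⟩
        obtain ⟨k, hk⟩ := hinter i j
        exact ⟨⟨k, (hmem_inter hk z).2 ⟨hi, hj⟩⟩, hk.trans_subset inter_subset_left,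
          hk.trans_subset inter_subset_right⟩) (by
        rintro ⟨i, hi⟩
        rw [nonempty_iff_ne_empty]
        intro h
        rw [h_empty i h] at hi
        exact hi) (fun i => (hC i).isCompact) fun i => hC i
    exact ⟨x, fun i hi => mem_iInter.1 hx ⟨i, hi⟩⟩
  choose f hf using hex
  refine ⟨f, continuous_def.2 fun O hO => isOpen_iff_forall_mem_open.2 fun z hz => ?_,
    fun x => ?_⟩
  · obtain ⟨i, j, hij, hzi, hjO⟩ := hbase (f z) O hO hz
    refine ⟨(ψ i : Set Z)ᶜ, fun z' hz' => hjO (hf z' j ((hcover hij z').resolve_left hz')),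
      (ψ i).isClosed.isOpen_compl, fun h => hzi (hf z i h)⟩
  · have : Nonempty {i // x ∈ C i} := ⟨⟨i₀, by rw [hi₀]; trivial⟩⟩
    obtain ⟨z, hz⟩ := IsCompact.nonempty_iInter_of_directed_nonempty_isCompact_isClosed
      (fun i : {i // x ∈ C i} => (ψ i : Set Z)) (by
        rintro ⟨i, hi⟩ ⟨j, hj⟩
        obtain ⟨k, hk⟩ := hinter i j
        exact ⟨⟨k, by rw [hk]; exact ⟨hi, hj⟩⟩, fun z hz => ((hmem_inter hk z).1 hz).1,
          fun z hz => ((hmem_inter hk z).1 hz).2⟩) (by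
        rintro ⟨i, hi⟩
        rw [nonempty_iff_ne_empty]
        exact fun h => h_nonempty i ⟨x, hi⟩ (Closeds.ext h))
        (fun i => (ψ i).isClosed.isCompact) fun i => (ψ i).isClosed
    refine ⟨z, ?_⟩
    by_contra hne
    obtain ⟨i, j, hij, hzi, hj⟩ := hbase (f z) {x}ᶜ isOpen_compl_singleton hne
    have hxi : x ∈ C i := by
      rcases (hij.ge (mem_univ x) : x ∈ C i ∪ C j) with h | h
      · exact h
      · exact absurd rfl (hj h)
    exact hzi (hf z i (mem_iInter.1 hz ⟨i, hxi⟩))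

/-- In a compact Hausdorff space the complements of finite unions of members of a base form a base
for the closed sets which separates points from closed sets. -/
theorem exists_separating_of_isTopologicalBasis {K : Type v} [TopologicalSpace K] [CompactSpace K]
    [T2Space K] {B : Set (Set K)} (hB : IsTopologicalBasis B) {x : K} {O : Set K} (hO : IsOpen O)
    (hx : x ∈ O) : ∃ s t : Finset B, (⋃ b ∈ s, (b : Set K))ᶜ ∪ (⋃ b ∈ t, (b : Set K))ᶜ = univ ∧
      x ∉ (⋃ b ∈ s, (b : Set K))ᶜ ∧ (⋃ b ∈ t, (b : Set K))ᶜ ⊆ O := by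
  obtain ⟨V, W, hV, hW, hxV, hOW, hVW⟩ := SeparatedNhds.of_isCompact_isCompact
    (isCompact_singleton (x := x)) hO.isClosed_compl.isCompact
    (disjoint_singleton_left.2 fun h => h hx)
  obtain ⟨b, hb, hxb, hbV⟩ := hB.exists_subset_of_mem_open (hxV rfl) hV
  obtain ⟨t, ht⟩ := hO.isClosed_compl.isCompact.elim_finite_subcover
    (fun c : {c : B // (c : Set K) ⊆ W} => ((c : B) : Set K)) (fun c => hB.isOpen c.1.2) (by
      intro y hy
      obtain ⟨c, hc, hyc, hcW⟩ := hB.exists_subset_of_mem_open (hOW hy) hW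
      exact mem_iUnion.2 ⟨⟨⟨c, hc⟩, hcW⟩, hyc⟩)
  refine ⟨{⟨b, hb⟩}, t.map (Function.Embedding.subtype _), ?_, ?_, ?_⟩
  · rw [← compl_inter, compl_univ_iff.2]
    rw [← disjoint_iff_inter_eq_empty]
    refine hVW.mono (by simpa using hbV) (iUnion₂_subset fun c hc => ?_)
    obtain ⟨c', -, rfl⟩ := Finset.mem_map.1 hc
    exact c'.2
  · simpa using hxb
  · rw [compl_subset_comm]
    refine ht.trans (iUnion₂_subset fun c hc => ?_)
    exact subset_biUnion_of_mem (u := fun b : B => (b : Set K))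
      (Finset.mem_map_of_mem (Function.Embedding.subtype _) hc)

/-- If the ultrapower is `κ`-saturated and is contained in the lattice of closed subsets of the
compact space `Z`, then every continuum of weight at most `κ` is a continuous image of `Z`. -/
theorem exists_continuous_surjective_of_isSaturated {u : Ultrafilter ℕ} {κ : Cardinal.{0}}
    (hκ : ℵ₀ ≤ κ) (hu : IsSaturated latticeLanguage (Ultrapower u rationalUnions) κ)
    {Z : Type} [TopologicalSpace Z] [CompactSpace Z]
    (e : Ultrapower u rationalUnions ↪[latticeLanguage] Closeds Z)
    (K : Type v) [TopologicalSpace K] [CompactSpace K] [T2Space K] [ConnectedSpace K]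
    (hK : weight K ≤ Cardinal.lift.{v} κ) : ∃ f : Z → K, Continuous f ∧ Function.Surjective f := by
  classical
  obtain ⟨B, hB, hBK⟩ : weight K ∈
      {κ | ∃ B : Set (Set K), IsTopologicalBasis B ∧ #B = κ} :=
    csInf_mem ⟨_, _, isTopologicalBasis_opens, rfl⟩
  have hcard : #(Finset B) ≤ Cardinal.lift.{v} κ := by
    have h0 : ℵ₀ ≤ Cardinal.lift.{v} κ := Cardinal.aleph0_le_lift.2 hκ
    rcases finite_or_infinite B with h | h
    · exact (Cardinal.lt_aleph0_of_finite _).le.trans h0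
    · rw [Cardinal.mk_finset_of_infinite, hBK]; exact hK
  -- The index set has to live in the universe of the ultrapower.
  obtain ⟨i⟩ : Nonempty (Finset B ↪ κ.out) := by
    rw [← Cardinal.lift_mk_le']
    simpa using hcard
  let ε : Finset B ≃ range i := Equiv.ofInjective i i.injective
  have hcard' : #(range i) ≤ κ := (Cardinal.mk_set_le _).trans_eq κ.mk_out
  let C (s : range i) : Set K := (⋃ b ∈ ε.symm s, (b : Set K))ᶜ
  have hC (s : range i) : IsClosed (C s) :=
    (isOpen_biUnion fun b _ => hB.isOpen b.2).isClosed_compl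
  obtain ⟨ψ, h1, h2, h3, h4⟩ := exists_representation_of_isSaturated hu e hcard' C hC
  refine exists_continuous_surjective_of_representation C hC ⟨ε ∅, by simp [C]⟩ ?_ ?_ ψ h1 h2 h3 h4
  · intro s t
    refine ⟨ε (ε.symm s ∪ ε.symm t), ?_⟩
    simp only [C, Equiv.symm_apply_apply, Finset.set_biUnion_union, compl_union]
  · intro x O hO hx
    obtain ⟨s, t, hst, hs, ht⟩ := exists_separating_of_isTopologicalBasis hB hO hx
    exact ⟨ε s, ε t, by simpa only [C, Equiv.symm_apply_apply] using hst,
      by simpa only [C, Equiv.symm_apply_apply] using hs,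
      by simpa only [C, Equiv.symm_apply_apply] using ht⟩

/-! ### Closures in the Čech–Stone compactification -/

/-- A Urysohn function separating `A` and `B` extends to the compactification. -/
theorem disjoint_closure_stoneCech {X : Type*} [TopologicalSpace X] [NormalSpace X] {A B : Set X}
    (hA : IsClosed A) (hB : IsClosed B) (hAB : Disjoint A B) :
    Disjoint (closure (stoneCechUnit '' A)) (closure (stoneCechUnit '' B)) := by
  obtain ⟨f, h0, h1, hf⟩ := exists_continuous_zero_one_of_isClosed hA hB hAB
  let g : X → unitInterval := fun x => ⟨f x, hf x⟩
  have hg : Continuous g := f.continuous.subtype_mk _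
  have hext := continuous_stoneCechExtend hg
  have hA' : closure (stoneCechUnit '' A) ⊆ stoneCechExtend hg ⁻¹' {0} := by
    refine closure_minimal ?_ (isClosed_singleton.preimage hext)
    rintro _ ⟨x, hx, rfl⟩
    rw [mem_preimage, stoneCechExtend_stoneCechUnit]
    exact Subtype.ext (h0 hx)
  have hB' : closure (stoneCechUnit '' B) ⊆ stoneCechExtend hg ⁻¹' {1} := by
    refine closure_minimal ?_ (isClosed_singleton.preimage hext)
    rintro _ ⟨x, hx, rfl⟩
    rw [mem_preimage, stoneCechExtend_stoneCechUnit]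
    exact Subtype.ext (h1 hx)
  exact (Disjoint.preimage _ (by simp)).mono hA' hB'

/-- A point in both closures and not in the closure of the intersection has a closed neighbourhood
in which the two sets are disjoint. -/
theorem closure_stoneCech_inter {X : Type*} [TopologicalSpace X] [NormalSpace X] {A B : Set X}
    (hA : IsClosed A) (hB : IsClosed B) :
    closure (stoneCechUnit '' (A ∩ B)) =
      closure (stoneCechUnit '' A) ∩ closure (stoneCechUnit '' B) := by
  refine Subset.antisymm (subset_inter (closure_mono (image_mono inter_subset_left))
    (closure_mono (image_mono inter_subset_right))) ?_
  rintro z ⟨hzA, hzB⟩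
  by_contra hz
  obtain ⟨N, hN, hNc, hNsub⟩ := exists_mem_nhds_isClosed_subset
    (isClosed_closure.isOpen_compl.mem_nhds hz)
  have hP : IsClosed (stoneCechUnit ⁻¹' N : Set X) := hNc.preimage continuous_stoneCechUnit
  have hloc {C : Set X} (hC : z ∈ closure (stoneCechUnit '' C)) :
      z ∈ closure (stoneCechUnit '' (C ∩ stoneCechUnit ⁻¹' N)) := by
    rw [image_inter_preimage, inter_comm]
    rw [mem_closure_iff_nhds] at hC ⊢
    intro t ht
    obtain ⟨y, ⟨hyt, hyN⟩, hyC⟩ := hC (t ∩ N) (inter_mem ht hN)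
    exact ⟨y, hyt, hyN, hyC⟩
  refine (disjoint_closure_stoneCech (hA.inter hP) (hB.inter hP) ?_).le_bot ⟨hloc hzA, hloc hzB⟩
  rw [disjoint_left]
  rintro x ⟨hxA, hxN⟩ ⟨hxB, -⟩
  exact hNsub hxN (subset_closure ⟨x, ⟨hxA, hxB⟩, rfl⟩)

/-! ### The sets `𝕀ᵤ` -/

/-- The closure in `β(ω × [0,1])` of the part of the strip over `U`. -/
def stripClosure (U : Set ℕ) : Set (StoneCech StripSpace) :=
  closure (stoneCechUnit '' (U ×ˢ (univ : Set unitInterval)))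

theorem isClosed_strip {A : Set StripSpace} (h : ∀ n, IsClosed {t | (n, t) ∈ A}) : IsClosed A := by
  rw [← isOpen_compl_iff, isOpen_iff_mem_nhds]
  rintro ⟨n, t⟩ ht
  rw [nhds_prod_eq, nhds_discrete, pure_prod]
  exact (h n).isOpen_compl.mem_nhds ht

theorem isClosed_prod_univ (U : Set ℕ) : IsClosed (U ×ˢ (univ : Set unitInterval)) :=
  (isClosed_discrete U).prod isClosed_univ

theorem stripClosure_mono {U V : Set ℕ} (h : U ⊆ V) : stripClosure U ⊆ stripClosure V :=
  closure_mono (image_mono (prod_mono h subset_rfl))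

theorem compl_stripClosure (U : Set ℕ) : (stripClosure U)ᶜ = stripClosure Uᶜ := by
  refine IsCompl.compl_eq (isCompl_iff.2 ⟨?_, ?_⟩)
  · refine disjoint_closure_stoneCech (isClosed_prod_univ U) (isClosed_prod_univ Uᶜ) ?_
    exact disjoint_compl_right.set_prod_left _ _
  · rw [codisjoint_iff, stripClosure, stripClosure]
    change closure _ ∪ closure _ = univ
    rw [← closure_union,
      ← image_union, ← union_prod, union_compl_self, univ_prod_univ, image_univ]
    exact denseRange_stoneCechUnit.closure_range

theorem isClopen_stripClosure (U : Set ℕ) : IsClopen (stripClosure U) := by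
  refine ⟨isClosed_closure, ?_⟩
  rw [← isClosed_compl_iff, compl_stripClosure]
  exact isClosed_closure

section StandardSet

variable {u : Ultrafilter ℕ}

theorem mem_standardSet {z : StoneCech StripSpace} :
    z ∈ standardSet u ↔ ∀ U ∈ u, z ∈ stripClosure U :=
  mem_iInter₂

theorem isClosed_standardSet : IsClosed (standardSet u) :=
  isClosed_biInter fun _ _ => isClosed_closure

instance : CompactSpace (standardSet u) :=
  isCompact_iff_compactSpace.1 isClosed_standardSet.isCompact

/-- Membership in the closure of a set is decided, for points of `𝕀ᵤ`, over any member of `u`. -/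
theorem mem_closure_inter_of_mem_standardSet {z : StoneCech StripSpace} (hz : z ∈ standardSet u)
    {A : Set StripSpace} (hA : z ∈ closure (stoneCechUnit '' A)) {U : Set ℕ} (hU : U ∈ u) :
    z ∈ closure (stoneCechUnit '' (A ∩ U ×ˢ univ)) := by
  rw [← inter_union_compl A (U ×ˢ univ), image_union, closure_union] at hA
  refine hA.resolve_right fun h => ?_
  have h' : z ∈ stripClosure Uᶜ := by
    refine closure_mono (image_mono ?_) h
    rintro ⟨n, t⟩ ⟨-, hn⟩
    exact ⟨fun hn' => hn ⟨hn', trivial⟩, trivial⟩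
  rw [← compl_stripClosure] at h'
  exact h' (mem_standardSet.1 hz U hU)

/-- A set that meets `u`-many of the intervals has a point of `𝕀ᵤ` in its closure. -/
theorem exists_mem_standardSet_closure {A : Set StripSpace}
    (hA : ∀ᶠ n in (u : Filter ℕ), ∃ t, (n, t) ∈ A) :
    ∃ z ∈ standardSet u, z ∈ closure (stoneCechUnit '' A) := by
  have : Nonempty {U : Set ℕ // U ∈ u} := ⟨⟨univ, univ_mem⟩⟩
  obtain ⟨z, hz⟩ := IsCompact.nonempty_iInter_of_directed_nonempty_isCompact_isClosed
    (fun U : {U : Set ℕ // U ∈ u} => closure (stoneCechUnit '' (A ∩ U.1 ×ˢ univ))) (by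
      rintro ⟨U, hU⟩ ⟨V, hV⟩
      refine ⟨⟨U ∩ V, inter_mem hU hV⟩, ?_, ?_⟩
      · exact closure_mono (image_mono (inter_subset_inter_right _
          (prod_mono inter_subset_left subset_rfl)))
      · exact closure_mono (image_mono (inter_subset_inter_right _
          (prod_mono inter_subset_right subset_rfl)))) (by
      rintro ⟨U, hU⟩
      obtain ⟨n, ⟨t, ht⟩, hn⟩ := (hA.and hU).exists
      exact ⟨_, subset_closure ⟨(n, t), ⟨ht, hn, trivial⟩, rfl⟩⟩)
    (fun _ => isClosed_closure.isCompact) fun _ => isClosed_closure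
  rw [mem_iInter] at hz
  exact ⟨z, mem_standardSet.2 fun U hU => closure_mono (image_mono inter_subset_right) (hz ⟨U, hU⟩),
    closure_mono (image_mono inter_subset_left) (hz ⟨univ, univ_mem⟩)⟩

/-- On `𝕀ᵤ` the closures of subsets of the strip are ordered by inclusion on `u`-many intervals,
provided that the larger set is closed. -/
theorem closure_subset_on_standardSet_iff {A B : Set StripSpace} (hB : IsClosed B) :
    (∀ z ∈ standardSet u, z ∈ closure (stoneCechUnit '' A) → z ∈ closure (stoneCechUnit '' B)) ↔
      ∀ᶠ n in (u : Filter ℕ), ∀ t, (n, t) ∈ A → (n, t) ∈ B := by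
  constructor
  · intro h
    by_contra hne
    rw [← Ultrafilter.eventually_not] at hne
    -- One point of `A \ B` on each such interval gives a closed set disjoint from `B`.
    let τ (n : ℕ) : unitInterval := Classical.epsilon fun t => (n, t) ∈ A \ B
    have hτ {n : ℕ} (hn : ¬∀ t, (n, t) ∈ A → (n, t) ∈ B) : (n, τ n) ∈ A \ B := by
      push Not at hn
      exact Classical.epsilon_spec (p := fun t => (n, t) ∈ A \ B) hn
    let D : Set StripSpace := {z | z ∈ A \ B ∧ z.2 = τ z.1}
    have hDc : IsClosed D := isClosed_strip fun n =>
      (Set.subsingleton_of_forall_eq (τ n) fun t ht => ht.2).isClosed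
    obtain ⟨z, hz, hzD⟩ := exists_mem_standardSet_closure (A := D)
      (hne.mono fun n hn => ⟨τ n, hτ hn, rfl⟩)
    have hzA := closure_mono (image_mono fun x (hx : x ∈ D) => hx.1.1) hzD
    exact (disjoint_closure_stoneCech hDc hB (disjoint_left.2 fun x hx => hx.1.2)).le_bot
      ⟨hzD, h z hz hzA⟩
  · intro h z hz hzA
    refine closure_mono (image_mono ?_) (mem_closure_inter_of_mem_standardSet hz hzA h)
    rintro ⟨n, t⟩ ⟨hA, hn, -⟩
    exact hn t hA

/-- By compactness, disjoint open sets that cover `𝕀ᵤ` cover some `cl (U × [0,1])` with `U ∈ u`;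
each interval over `U` lies in one of them, and the ultrafilter decides for one of the two. -/
theorem isPreconnected_standardSet : IsPreconnected (standardSet u) := by
  rw [isPreconnected_iff_subset_of_fully_disjoint_closed isClosed_standardSet]
  intro P Q hP hQ hPQ hdisj
  obtain ⟨O₁, O₂, hO₁, hO₂, hPO, hQO, hO⟩ := SeparatedNhds.of_isCompact_isCompact
    hP.isCompact hQ.isCompact hdisj
  obtain ⟨⟨U, hU⟩, hUO⟩ : ∃ U : {U : Set ℕ // U ∈ u}, stripClosure U ⊆ O₁ ∪ O₂ := by
    have : Nonempty {U : Set ℕ // U ∈ u} := ⟨⟨univ, univ_mem⟩⟩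
    refine exists_subset_nhds_of_isCompact' ?_ (fun _ => isClosed_closure.isCompact)
      (fun _ => isClosed_closure) fun z hz => (hO₁.union hO₂).mem_nhds ?_
    · rintro ⟨U, hU⟩ ⟨V, hV⟩
      exact ⟨⟨U ∩ V, inter_mem hU hV⟩, stripClosure_mono inter_subset_left,
        stripClosure_mono inter_subset_right⟩
    · exact union_subset_union hPO hQO
        (hPQ (mem_standardSet.2 fun U hU => mem_iInter.1 hz ⟨U, hU⟩))
  have hfib : ∀ᶠ n in (u : Filter ℕ),
      (∀ t : unitInterval, stoneCechUnit ((n, t) : StripSpace) ∈ O₁) ∨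
        ∀ t : unitInterval, stoneCechUnit ((n, t) : StripSpace) ∈ O₂ := by
    filter_upwards [hU] with n hn
    have hpre : IsPreconnected
        (range fun t : unitInterval => stoneCechUnit ((n, t) : StripSpace)) :=
      isPreconnected_range (continuous_stoneCechUnit.comp (by fun_prop))
    have hsub : (range fun t : unitInterval => stoneCechUnit ((n, t) : StripSpace)) ⊆ O₁ ∪ O₂ := by
      rintro _ ⟨t, rfl⟩
      exact hUO (subset_closure ⟨(n, t), ⟨hn, trivial⟩, rfl⟩)
    refine (hpre.subset_or_subset hO₁ hO₂ hO hsub).imp ?_ ?_ <;>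
      exact fun h t => h ⟨t, rfl⟩
  have main {O O' R : Set (StoneCech StripSpace)} (hO' : IsOpen O') (hOO : Disjoint O O')
      (hR : R ⊆ O') (h : ∀ᶠ n in (u : Filter ℕ),
        ∀ t : unitInterval, stoneCechUnit ((n, t) : StripSpace) ∈ O) {z} (hz : z ∈ standardSet u) :
      z ∉ R := by
    intro hzR
    have : stripClosure {n | ∀ t : unitInterval, stoneCechUnit ((n, t) : StripSpace) ∈ O} ⊆
        closure O := by
      refine closure_mono ?_
      rintro _ ⟨⟨n, t⟩, ⟨hn, -⟩, rfl⟩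
      exact hn t
    exact (hOO.closure_left hO').le_bot ⟨this (mem_standardSet.1 hz _ h), hR hzR⟩
  rcases Ultrafilter.eventually_or.1 hfib with h | h
  · exact .inl fun z hz => (hPQ hz).resolve_right (main hO₂ hO hQO h hz)
  · exact .inr fun z hz => (hPQ hz).resolve_left (main hO₁ hO.symm hPO h hz)

theorem standardSet_nonempty : (standardSet u).Nonempty := by
  obtain ⟨z, hz, -⟩ := exists_mem_standardSet_closure (u := u) (A := univ)
    (Eventually.of_forall fun n => ⟨0, trivial⟩)
  exact ⟨z, hz⟩

theorem standardSet_subset_remainder (hu : (u : Filter ℕ) ≤ cofinite) :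
    standardSet u ⊆ remainder := by
  rintro _ hz ⟨⟨n, t⟩, rfl⟩
  have hU : ({n}ᶜ : Set ℕ) ∈ u := hu (finite_singleton n).compl_mem_cofinite
  have h1 := mem_standardSet.1 hz _ hU
  rw [← compl_stripClosure] at h1
  exact h1 (subset_closure ⟨(n, t), ⟨rfl, trivial⟩, rfl⟩)

/-- The clopen sets `cl (U × [0,1])`, `U ∈ u`, confine the component to `𝕀ᵤ`. -/
theorem connectedComponentIn_remainder (hu : (u : Filter ℕ) ≤ cofinite)
    {x : StoneCech StripSpace} (hx : x ∈ standardSet u) :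
    connectedComponentIn remainder x = standardSet u := by
  refine Subset.antisymm (fun y hy => mem_standardSet.2 fun U hU => ?_)
    (isPreconnected_standardSet.subset_connectedComponentIn hx (standardSet_subset_remainder hu))
  exact isPreconnected_connectedComponentIn.subset_isClopen (isClopen_stripClosure U)
    ⟨x, mem_connectedComponentIn (standardSet_subset_remainder hu hx),
      mem_standardSet.1 hx U hU⟩ hy

/-! ### The lattice of traces -/

/-- The set `⋃ₙ {n} × Fₙ`. -/
def stripUnion (F : ℕ → rationalUnions) : Set StripSpace :=
  {z : StripSpace | z.2 ∈ (F z.1 : Set unitInterval)}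

theorem isClosed_stripUnion (F : ℕ → rationalUnions) : IsClosed (stripUnion F) :=
  isClosed_strip fun n => isClosed_coe_rationalUnions (F n)

theorem mem_trace {F : ℕ → rationalUnions} {z : standardSet u} :
    z ∈ trace u F ↔ (z : StoneCech StripSpace) ∈ closure (stoneCechUnit '' stripUnion F) :=
  Iff.rfl

theorem isClosed_trace (F : ℕ → rationalUnions) : IsClosed (trace u F) :=
  isClosed_closure.preimage continuous_subtype_val

theorem trace_subset_trace_iff {F G : ℕ → rationalUnions} :
    trace u F ⊆ trace u G ↔ ∀ᶠ n in (u : Filter ℕ), F n ≤ G n := by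
  refine Iff.trans ?_ (closure_subset_on_standardSet_iff (A := stripUnion F)
    (isClosed_stripUnion G))
  exact ⟨fun h z hz hF => h (a := ⟨z, hz⟩) hF, fun h z hF => h z z.2 hF⟩

theorem trace_eq_trace_iff {F G : ℕ → rationalUnions} :
    trace u F = trace u G ↔ ∀ᶠ n in (u : Filter ℕ), F n = G n := by
  rw [Subset.antisymm_iff, trace_subset_trace_iff, trace_subset_trace_iff, ← eventually_and]
  simp only [le_antisymm_iff]

theorem trace_sup (F G : ℕ → rationalUnions) :
    trace u (fun n => F n ⊔ G n) = trace u F ∪ trace u G := by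
  have : stripUnion (fun n => F n ⊔ G n) = stripUnion F ∪ stripUnion G := rfl
  ext z
  rw [mem_union, mem_trace, mem_trace, mem_trace, this, image_union, closure_union, mem_union]

theorem trace_inf (F G : ℕ → rationalUnions) :
    trace u (fun n => F n ⊓ G n) = trace u F ∩ trace u G := by
  have : stripUnion (fun n => F n ⊓ G n) = stripUnion F ∩ stripUnion G := rfl
  ext z
  rw [mem_inter_iff, mem_trace, mem_trace, mem_trace, this,
    closure_stoneCech_inter (isClosed_stripUnion F) (isClosed_stripUnion G), mem_inter_iff]

theorem trace_bot : trace u (fun _ => ⊥) = ∅ := by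
  have : stripUnion (fun _ => ⊥) = ∅ := rfl
  ext z
  rw [mem_trace, this]
  simp

theorem trace_top : trace u (fun _ => ⊤) = univ := by
  have : stripUnion (fun _ => ⊤) = univ := rfl
  ext z
  rw [mem_trace, this, image_univ, denseRange_stoneCechUnit.closure_range]
  simp

/-- The embedding of `𝓘^ω/u` into the lattice of closed subsets of `𝕀ᵤ` induced by the traces. -/
def traceEmbedding (u : Ultrafilter ℕ) :
    Ultrapower u rationalUnions ↪[latticeLanguage] Closeds (standardSet u) where
  toFun := Quotient.lift (fun F => (⟨trace u F, isClosed_trace F⟩ : Closeds (standardSet u)))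
    fun _ _ h => Closeds.ext (trace_eq_trace_iff.2 h)
  inj' := by
    intro a b h
    obtain ⟨F, rfl⟩ := Ultrapower.mk_surjective u a
    obtain ⟨G, rfl⟩ := Ultrapower.mk_surjective u b
    exact Ultrapower.mk_eq_mk.2 (trace_eq_trace_iff.1 (congrArg SetLike.coe h))
  map_fun' := by
    intro n f x
    choose X hX using fun i => Ultrapower.mk_surjective u (x i)
    obtain rfl : (fun i => Ultrapower.mk u (X i)) = x := funext hX
    have h := Ultraproduct.funMap_cast (u := u) (M := fun _ => rationalUnions) f X
    refine (congrArg _ h).trans (Closeds.ext ?_)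
    cases f with
    | bot => exact trace_bot
    | top => exact trace_top
    | sup => exact trace_sup _ _
    | inf => exact trace_inf _ _
  map_rel' := fun r => r.elim

theorem coe_traceEmbedding_mk (F : ℕ → rationalUnions) :
    (traceEmbedding u (Ultrapower.mk u F) : Set (standardSet u)) = trace u F := rfl

/-- Between a closed and an open subset of `[0,1]` there is a finite union of rational intervals. -/
theorem exists_rationalUnions_between {P Q : Set unitInterval} (hP : IsClosed P) (hQ : IsOpen Q)
    (hPQ : P ⊆ Q) : ∃ A : rationalUnions, P ⊆ A ∧ (A : Set unitInterval) ⊆ Q := by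
  have hloc (t : unitInterval) (ht : t ∈ Q) : ∃ p : unitInterval × unitInterval,
      (IsRationalPoint p.1 ∧ IsRationalPoint p.2) ∧ Icc p.1 p.2 ∈ 𝓝 t ∧ Icc p.1 p.2 ⊆ Q := by
    obtain ⟨ε, hε, hball⟩ := Metric.isOpen_iff.1 hQ t ht
    obtain ⟨q, hq1, hq2⟩ := exists_rat_btwn (sub_lt_self (t : ℝ) hε)
    obtain ⟨r, hr1, hr2⟩ := exists_rat_btwn (lt_add_of_pos_right (t : ℝ) hε)
    let c (s : ℚ) : unitInterval := projIcc (0 : ℝ) 1 zero_le_one s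
    have hc (s : ℚ) : (c s : ℝ) = max 0 (min 1 (s : ℝ)) := rfl
    have hrat (s : ℚ) : IsRationalPoint (c s) := ⟨max 0 (min 1 s), by rw [hc]; push_cast; rfl⟩
    refine ⟨(c q, c r), ⟨hrat q, hrat r⟩, ?_, fun x hx => hball ?_⟩
    · have : Subtype.val ⁻¹' Ioo (q : ℝ) r ∈ 𝓝 t :=
        continuous_subtype_val.continuousAt.preimage_mem_nhds (Ioo_mem_nhds hq2 hr1)
      refine mem_of_superset this fun x hx => ⟨?_, ?_⟩
      · rw [← Subtype.coe_le_coe, hc]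
        exact max_le x.2.1 ((min_le_right _ _).trans hx.1.le)
      · rw [← Subtype.coe_le_coe, hc]
        exact le_max_of_le_right (le_min x.2.2 hx.2.le)
    · have h1 := hx.1
      have h2 := hx.2
      rw [← Subtype.coe_le_coe, hc] at h1 h2
      have h3 : (q : ℝ) ≤ x := by
        rw [min_eq_right (hq2.le.trans t.2.2)] at h1
        exact (le_max_right _ _).trans h1
      have h4 : (x : ℝ) ≤ r := by
        rw [max_eq_right (le_min zero_le_one (t.2.1.trans hr1.le))] at h2
        exact h2.trans (min_le_right _ _)
      rw [Metric.mem_ball, Subtype.dist_eq, Real.dist_eq, abs_lt]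
      constructor <;> linarith
  choose! p hp hn hs using hloc
  obtain ⟨T, hT, hcov⟩ := hP.isCompact.elim_nhds_subcover (fun t => Icc (p t).1 (p t).2)
    fun t ht => hn t (hPQ ht)
  refine ⟨⟨⋃ r ∈ p '' T, Icc r.1 r.2, p '' T, T.finite_toSet.image p, ?_, rfl⟩, ?_, ?_⟩
  · rintro _ ⟨t, ht, rfl⟩
    exact hp t (hPQ (hT t ht))
  · intro x hx
    obtain ⟨t, ht, hxt⟩ := mem_iUnion₂.1 (hcov hx)
    exact mem_iUnion₂.2 ⟨p t, mem_image_of_mem p ht, hxt⟩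
  · refine iUnion₂_subset ?_
    rintro _ ⟨t, ht, rfl⟩
    exact hs t (hPQ (hT t ht))

/-- A function that separates a point from a closed set is approximated on each interval by a finite
union of rational intervals between two of its level sets. -/
theorem isClosedBase_range_traceEmbedding (u : Ultrafilter ℕ) :
    IsClosedBase (range fun a => (traceEmbedding u a : Set (standardSet u))) := by
  refine isTopologicalBasis_of_isOpen_of_nhds ?_ ?_
  · rintro _ ⟨_, ⟨a, rfl⟩, rfl⟩
    exact (traceEmbedding u a).isClosed.isOpen_compl
  · rintro x O hx hO
    obtain ⟨O', hO', rfl⟩ := isOpen_induced_iff.1 hO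
    obtain ⟨f, h0, h1, hf⟩ := exists_continuous_zero_one_of_isClosed
      (isClosed_singleton (x := (x : StoneCech StripSpace))) hO'.isClosed_compl
      (disjoint_singleton_left.2 fun h => h hx)
    have hfn (n : ℕ) : Continuous fun t : unitInterval => f (stoneCechUnit ((n, t) : StripSpace)) :=
      f.continuous.comp (continuous_stoneCechUnit.comp (by fun_prop))
    choose F hF1 hF2 using fun n => exists_rationalUnions_between
      (P := {t | 2 / 3 ≤ f (stoneCechUnit ((n, t) : StripSpace))})
      (Q := {t | 1 / 3 < f (stoneCechUnit ((n, t) : StripSpace))})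
      (isClosed_le continuous_const (hfn n)) (isOpen_lt continuous_const (hfn n))
      (fun t ht => lt_of_lt_of_le (by norm_num : (1 / 3 : ℝ) < 2 / 3) (mem_ofPred.1 ht))
    refine ⟨(trace u F)ᶜ, ⟨_, ⟨Ultrapower.mk u F, rfl⟩, rfl⟩, fun hxF => ?_, fun z hz => ?_⟩
    · have hsub : closure (stoneCechUnit '' stripUnion F) ⊆ {z | 1 / 3 ≤ f z} := by
        refine closure_minimal ?_ (isClosed_le continuous_const f.continuous)
        rintro _ ⟨⟨n, t⟩, ht, rfl⟩
        exact (mem_ofPred.1 (hF2 n ht)).le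
      have := hsub (mem_trace.1 hxF)
      rw [mem_ofPred_eq, h0 rfl] at this
      norm_num at this
    · by_contra hzO
      refine hz (mem_trace.2 ?_)
      have hz1 : f z = 1 := h1 hzO
      have hopen : IsOpen {z | 2 / 3 < f z} := isOpen_lt continuous_const f.continuous
      have hzmem : (z : StoneCech StripSpace) ∈ {z | 2 / 3 < f z} := by
        rw [mem_ofPred_eq, hz1]; norm_num
      refine closure_mono ?_ (denseRange_stoneCechUnit.open_subset_closure_inter hopen hzmem)
      rintro _ ⟨hy, ⟨⟨n, t⟩, rfl⟩⟩
      exact ⟨(n, t), hF1 n (mem_ofPred.2 (mem_ofPred.1 hy).le), rfl⟩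

/-! ### The weight of `𝕀ᵤ` -/

theorem weight_le_mk {X : Type v} [TopologicalSpace X] {B : Set (Set X)}
    (hB : IsTopologicalBasis B) : weight X ≤ #B :=
  csInf_le' ⟨B, hB, rfl⟩

/-- A family of pairwise disjoint nonempty open sets is no larger than the weight. -/
theorem mk_le_weight_of_pairwise_disjoint {X ι : Type v} [TopologicalSpace X] (O : ι → Set X)
    (hO : ∀ i, IsOpen (O i)) (hne : ∀ i, (O i).Nonempty)
    (hd : Pairwise (Function.onFun Disjoint O)) :
    #ι ≤ weight X := by
  refine le_csInf ⟨_, _, isTopologicalBasis_opens, rfl⟩ ?_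
  rintro _ ⟨B, hB, rfl⟩
  choose x hx using hne
  choose b hb hxb hbO using fun i => hB.exists_subset_of_mem_open (hx i) (hO i)
  refine Cardinal.mk_le_of_injective (f := fun i => (⟨b i, hb i⟩ : B)) fun i j h => ?_
  by_contra hij
  have h' : b i = b j := congrArg Subtype.val h
  exact (hd hij).le_bot ⟨hbO i (hxb i), hbO j (h' ▸ hxb i)⟩

/-- Continuum many sequences of natural numbers, any two of which differ from some index on: the
sequences of codes of the initial segments of the branches of the binary tree. -/
theorem exists_eventually_different :
    ∃ ρ : (ℕ → Bool) → ℕ → ℕ, ∀ r s, r ≠ s → ∀ᶠ n in atTop, ρ r n ≠ ρ s n := by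
  refine ⟨fun r n => Encodable.encode ((List.range n).map r), fun r s hrs => ?_⟩
  obtain ⟨m, hm⟩ := Function.ne_iff.1 hrs
  filter_upwards [eventually_gt_atTop m] with n hn h
  exact hm (List.map_inj_left.1 (Encodable.encode_injective h) m (List.mem_range.2 hn))

/-- The complements of the traces of `{(n, t) | t ∉ J (ρ r n)}`, for pairwise disjoint open `J k`
and eventually different sequences `ρ r`, are pairwise disjoint nonempty open sets. -/
theorem continuum_le_weight_standardSet (hu : (u : Filter ℕ) ≤ cofinite) :
    𝔠 ≤ weight (standardSet u) := by
  have : Infinite unitInterval := (Icc_infinite (zero_lt_one : (0 : ℝ) < 1)).to_subtype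
  obtain ⟨J, hJinf, hJo, hJd⟩ := exists_seq_infinite_isOpen_pairwise_disjoint unitInterval
  obtain ⟨ρ, hρ⟩ := exists_eventually_different
  let A (r : ℕ → Bool) : Set StripSpace := {z | z.2 ∉ J (ρ r z.1)}
  have hA (r : ℕ → Bool) : IsClosed (A r) := isClosed_strip fun n =>
    (hJo (ρ r n)).isClosed_compl
  have h := mk_le_weight_of_pairwise_disjoint
    (fun r => (Subtype.val ⁻¹' (closure (stoneCechUnit '' A r))ᶜ : Set (standardSet u)))
    (fun r => isClosed_closure.isOpen_compl.preimage continuous_subtype_val) ?_ ?_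
  · rwa [Cardinal.mk_arrow, Cardinal.mk_bool, Cardinal.mk_nat, Cardinal.lift_id, Cardinal.lift_id,
      Cardinal.two_power_aleph0] at h
  · intro r
    by_contra hempty
    have hall : ∀ z ∈ standardSet u, z ∈ closure (stoneCechUnit '' (univ : Set StripSpace)) →
        z ∈ closure (stoneCechUnit '' A r) := by
      intro z hz _
      by_contra hzA
      exact hempty ⟨⟨z, hz⟩, hzA⟩
    obtain ⟨n, hn⟩ := ((closure_subset_on_standardSet_iff (hA r)).1 hall).exists
    obtain ⟨t, ht⟩ := (hJinf (ρ r n)).nonempty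
    exact hn t trivial ht
  · intro r s hrs
    refine disjoint_left.2 fun z hzr hzs => ?_
    have hev : ∀ᶠ n in (u : Filter ℕ), ∀ t : unitInterval, ((n, t) : StripSpace) ∈ univ →
        (n, t) ∈ A r ∪ A s := by
      have := hu (by rw [Nat.cofinite_eq_atTop]; exact hρ r s hrs)
      filter_upwards [this] with n hn t _
      by_contra ht
      rw [mem_union, not_or] at ht
      exact (hJd hn).le_bot ⟨not_not.1 ht.1, not_not.1 ht.2⟩
    have hz := (closure_subset_on_standardSet_iff ((hA r).union (hA s))).2 hev z z.2
      (by rw [image_univ, denseRange_stoneCechUnit.closure_range]; trivial)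
    rw [image_union, closure_union] at hz
    exact hz.elim hzr hzs

theorem weight_standardSet (hu : (u : Filter ℕ) ≤ cofinite) : weight (standardSet u) = 𝔠 := by
  refine le_antisymm ?_ (continuum_le_weight_standardSet hu)
  refine (weight_le_mk (isClosedBase_range_traceEmbedding u)).trans
    (Cardinal.mk_image_le.trans (Cardinal.mk_range_le.trans ?_))
  refine (Cardinal.mk_le_of_surjective (Ultrapower.mk_surjective u)).trans ?_
  rw [Cardinal.mk_arrow, Cardinal.mk_nat, Cardinal.lift_id, Cardinal.lift_id,
    ← Cardinal.aleph0_power_aleph0]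
  exact Cardinal.power_le_power_right Cardinal.mk_le_aleph0

end StandardSet

end UniversalContinuum

theorem mainTheorem5 (u : Ultrafilter ℕ) :
    ((u : Filter ℕ) ≤ Filter.cofinite →
      (IsCompact (UniversalContinuum.standardSet u) ∧
        IsConnected (UniversalContinuum.standardSet u) ∧
        UniversalContinuum.standardSet u ⊆ UniversalContinuum.remainder ∧
        (∀ x ∈ UniversalContinuum.standardSet u,
          connectedComponentIn UniversalContinuum.remainder x =
            UniversalContinuum.standardSet u)) ∧
      UniversalContinuum.weight (UniversalContinuum.standardSet u) = 𝔠 ∧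
      (∃ e : UniversalContinuum.Ultrapower u UniversalContinuum.rationalUnions
            ↪[UniversalContinuum.latticeLanguage]
            TopologicalSpace.Closeds (UniversalContinuum.standardSet u),
        (∀ F : ℕ → UniversalContinuum.rationalUnions,
          (e (UniversalContinuum.Ultrapower.mk u F) : Set (UniversalContinuum.standardSet u)) =
            UniversalContinuum.trace u F) ∧
        UniversalContinuum.IsClosedBase
          (Set.range fun a => (e a : Set (UniversalContinuum.standardSet u)))) ∧
      UniversalContinuum.IsSaturated UniversalContinuum.latticeLanguage
        (UniversalContinuum.Ultrapower u UniversalContinuum.rationalUnions) (Cardinal.aleph 1) ∧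
      ∀ (K : Type v) [TopologicalSpace K] [CompactSpace K] [T2Space K] [ConnectedSpace K],
        UniversalContinuum.weight K ≤ Cardinal.aleph 1 →
          ∃ f : UniversalContinuum.standardSet u → K, Continuous f ∧ Function.Surjective f) ∧
    (UniversalContinuum.IsSaturatedUltrafilter u 𝔠 →
      (u : Filter ℕ) ≤ Filter.cofinite ∧
      UniversalContinuum.IsSaturated UniversalContinuum.latticeLanguage
        (UniversalContinuum.Ultrapower u UniversalContinuum.rationalUnions) 𝔠 ∧
      UniversalContinuum.IsUniversal UniversalContinuum.latticeLanguage
        (UniversalContinuum.Ultrapower u UniversalContinuum.rationalUnions) (Order.succ 𝔠) ∧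
      ∀ (K : Type v) [TopologicalSpace K] [CompactSpace K] [T2Space K] [ConnectedSpace K],
        UniversalContinuum.weight K ≤ 𝔠 →
          ∃ f : UniversalContinuum.standardSet u → K, Continuous f ∧ Function.Surjective f) := by
  open UniversalContinuum in
  refine ⟨fun hu => ?_, fun hu => ?_⟩
  · have hsat := isSaturated_ultrapower_aleph_one latticeLanguage rationalUnions u hu
    refine ⟨⟨isClosed_standardSet.isCompact, ⟨standardSet_nonempty, isPreconnected_standardSet⟩,
      standardSet_subset_remainder hu, fun x hx => connectedComponentIn_remainder hu hx⟩,
      weight_standardSet hu, ⟨traceEmbedding u, coe_traceEmbedding_mk,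
        isClosedBase_range_traceEmbedding u⟩, hsat, fun K _ _ _ _ hK => ?_⟩
    exact exists_continuous_surjective_of_isSaturated (Cardinal.aleph0_le_aleph 1) hsat
      (traceEmbedding u) K (by simpa using hK)
  · have hsat := hu latticeLanguage rationalUnions
    refine ⟨hu.le_cofinite, hsat, hsat.isUniversal, fun K _ _ _ _ hK => ?_⟩
    exact exists_continuous_surjective_of_isSaturated Cardinal.aleph0_le_continuum hsat
      (traceEmbedding u) K (by simpa using hK)
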